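/- **Conventions.** Let $X$ be a connected (abstract) simplicial complex. Write $d$ for the combinatorial metric on the vertices (the least number of edges of a path in the $1$-skeleton), and $u\sim v$ if $u=v$ or $\{u,v\}$ is an edge of $X$. The ball $B_i(O)$, respectively the sphere $S_i(O)$, is the full subcomplex spanned by the vertices at distance at most $i$ from $O$, respectively exactly $i$. The link $X_\sigma$ of a simplex $\sigma$ consists of the simplices disjoint from $\sigma$ that together with $\sigma$ span a simplex of $X$. - $X$ is *uniformly locally finite* if there is a common bound on the number of simplices containing a given vertex. - $X$ is *flag* if every non-empty finite set of pairwise adjacent vertices spans a simplex. $X$ is *$8$-located* if it is flag and every cycle of length at most $8$ in $X$ that is full as a subcomplex and homotopically trivial in $X$ is contained in a ball $B_1(c)$ for some vertex $c$. - $X$ has the *$SD'$-property* if for every vertex $O$ and every integer $i\ge 1$: (T) for every edge $e\in S_{i+1}(O)$ the intersection $X_e\cap B_i(O)$ is non-empty; (V) for every vertex $v\in S_{i+1}(O)$ and all vertices $u,w\in X_v\cap B_i(O)$ there is a vertex $t\in X_v\cap B_i(O)$ with $t\sim u$ and $t\sim w$. - A *simplicial isometry* of $X$ is a simplicial automorphism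 $h$ of $X$. Its *translation length* is $|h|=\min_x d(h(x),x)$, over the vertices $x$. A simplex $\sigma$ is *$h$-invariant* if $h(\sigma)=\sigma$; $h$ is *elliptic* if there is an $h$-invariant simplex and *hyperbolic* otherwise. - A *bi-infinite geodesic* is a map $\gamma$ from $\mathbb Z$ to the vertices of $X$ with $d(\gamma(m),\gamma(n))=|m-n|$ for all $m,n$. A *thick geodesic* in $X$ is the full subcomplex of $X$ spanned by the union of a non-empty family of bi-infinite geodesics whose mutual Hausdorff distances have a common finite bound. **Theorem 3.8.** Let $h$ be a simplicial isometry of a connected, uniformly locally finite, $8$-located simplicial complex $X$ with the $SD'$-property, and assume $|h|>3$. Then either there is an $h$-invariant simplex of $X$ (elliptic case), or $h$ is hyperbolic and there is an $h$-invariant thick geodesic in $X$, i.e. a thick geodesic $K$ with $h(K)=K$ (hyperbolic case). -/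

import Mathlib

namespace LocatedComplex

universe u

variable {V : Type u}

/-- The `1`-skeleton of `X`, as a graph: two distinct vertices are adjacent iff they lie in a common
simplex. The combinatorial metric on the vertices of a connected `X` is `(skel X).dist`. -/
def skel (X : AbstractSimplicialComplex V) : SimpleGraph V where
  Adj u v := u ≠ v ∧ ∃ σ ∈ X, u ∈ σ ∧ v ∈ σ
  symm := ⟨fun _ _ h => ⟨h.1.symm, h.2.imp fun _ k => ⟨k.1, k.2.2, k.2.1⟩⟩⟩
  loopless := ⟨fun _ h => h.1 rfl⟩

/-- The relation `u ∼ v`: equal or joined by an edge. -/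
def Near (X : AbstractSimplicialComplex V) (u v : V) : Prop :=
  u = v ∨ (skel X).Adj u v

/-- Every non-empty finite set of pairwise adjacent vertices is a simplex. -/
def IsFlag (X : AbstractSimplicialComplex V) : Prop :=
  ∀ σ : Finset V, σ.Nonempty → (∀ u ∈ σ, ∀ v ∈ σ, u ≠ v → (skel X).Adj u v) → σ ∈ X

/-- There is a common bound on the number of simplices containing a given vertex. -/
def UniformlyLocallyFinite (X : AbstractSimplicialComplex V) : Prop :=
  ∃ N : ℕ, ∀ v : V, {σ : Finset V | σ ∈ X ∧ v ∈ σ}.encard ≤ N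

/-- The full subcomplex of `X` spanned by a set `S` of vertices. -/
def fullSubcomplex (X : AbstractSimplicialComplex V) (S : Set V) :
    PreAbstractSimplicialComplex V where
  faces := {σ | σ ∈ X ∧ ∀ v ∈ σ, v ∈ S}
  isRelLowerSet_faces := by
    rintro σ ⟨hσ, hS⟩
    refine ⟨(X.isRelLowerSet_faces hσ).1, fun τ hτ hne => ⟨?_, fun v hv => hS v (hτ hv)⟩⟩
    exact (X.isRelLowerSet_faces hσ).2 hτ hne

/-- The ball of radius `i` around `O`. -/
def ball (X : AbstractSimplicialComplex V) (i : ℕ) (O : V) : PreAbstractSimplicialComplex V :=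
  fullSubcomplex X {v | (skel X).dist O v ≤ i}

/-- The sphere of radius `i` around `O`. -/
def sphere (X : AbstractSimplicialComplex V) (i : ℕ) (O : V) : PreAbstractSimplicialComplex V :=
  fullSubcomplex X {v | (skel X).dist O v = i}

/-- The link of `σ` in `X`: the simplices disjoint from `σ` that together with `σ` span a simplex. -/
def link (X : AbstractSimplicialComplex V) (σ : Finset V) : PreAbstractSimplicialComplex V where
  faces := {τ | τ.Nonempty ∧ Disjoint τ σ ∧ ∃ ρ ∈ X, τ ⊆ ρ ∧ σ ⊆ ρ}
  isRelLowerSet_faces := by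
    rintro τ ⟨hne, hd, ρ, hρ, h1, h2⟩
    refine ⟨hne, fun τ' hτ' hne' => ⟨hne', ?_, ρ, hρ, hτ'.trans h1, h2⟩⟩
    exact Disjoint.mono_left hτ' hd

/-- Elementary moves on edge paths, given as lists of vertices in which consecutive vertices are
equal or adjacent: a step from `a` to `b` followed by a step from `b` to `c` is replaced by a step
from `a` to `c` if `a`, `b`, `c` lie in a common simplex, and a constant step is removed. -/
inductive EdgePathMove (X : AbstractSimplicialComplex V) : List V → List V → Prop
  | short (l l' : List V) (a b c : V) (h : ∃ σ ∈ X, a ∈ σ ∧ b ∈ σ ∧ c ∈ σ) :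
      EdgePathMove X (l ++ [a, b, c] ++ l') (l ++ [a, c] ++ l')
  | stat (l l' : List V) (a : V) : EdgePathMove X (l ++ [a, a] ++ l') (l ++ [a] ++ l')

/-- A closed edge path is homotopically trivial if it is equivalent to the constant path, for the
equivalence relation generated by the elementary moves (all of which fix the endpoints); this is
triviality in the edge-path group, that is, in the fundamental group of `X`. -/
def HomotopicallyTrivial (X : AbstractSimplicialComplex V) {a : V} (γ : (skel X).Walk a a) : Prop :=
  Relation.EqvGen (EdgePathMove X) γ.support [a]

/-- The cycle `γ` is full as a subcomplex: every simplex of `X` whose vertices are on `γ` is a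
simplex (a vertex or an edge) of `γ`. -/
def IsFullCycle (X : AbstractSimplicialComplex V) {a : V} (γ : (skel X).Walk a a) : Prop :=
  γ.IsCycle ∧ ∀ σ ∈ X, (∀ v ∈ σ, v ∈ γ.support) → ∃ e ∈ γ.edges, ∀ v ∈ σ, v ∈ e

/-- `X` is `m`-located: it is flag and every full homotopically trivial loop of length at most `m`
is contained in a `1`-ball. -/
def IsLocated (X : AbstractSimplicialComplex V) (m : ℕ) : Prop :=
  IsFlag X ∧ ∀ (a : V) (γ : (skel X).Walk a a), IsFullCycle X γ → HomotopicallyTrivial X γ →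
    γ.length ≤ m → ∃ c : V, ∀ v ∈ γ.support, {v} ∈ ball X 1 c

/-- The triangle condition at the vertex `O`, for the radius `i`. -/
def TriangleCondition (X : AbstractSimplicialComplex V) (O : V) (i : ℕ) : Prop :=
  ∀ e ∈ sphere X (i + 1) O, e.card = 2 → ∃ τ, τ ∈ link X e ⊓ ball X i O

/-- The vertex condition at the vertex `O`, for the radius `i`. -/
def VertexCondition (X : AbstractSimplicialComplex V) (O : V) (i : ℕ) : Prop :=
  ∀ v : V, {v} ∈ sphere X (i + 1) O → ∀ u w : V,
    {u} ∈ link X {v} ⊓ ball X i O → {w} ∈ link X {v} ⊓ ball X i O →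
    ∃ t : V, {t} ∈ link X {v} ⊓ ball X i O ∧ Near X t u ∧ Near X t w

/-- The property `SD'ₙ(O)`. -/
def SDPrimeAt (X : AbstractSimplicialComplex V) (n : ℕ) (O : V) : Prop :=
  ∀ i ∈ Finset.Icc 1 n, TriangleCondition X O i ∧ VertexCondition X O i

/-- The property `SD'`. -/
def SDPrime (X : AbstractSimplicialComplex V) : Prop :=
  ∀ (n : ℕ) (O : V), SDPrimeAt X n O

/-- A simplicial isometry of `X`: a simplicial automorphism, given by a bijection `h` of the vertices
such that `h` and its inverse map simplices to simplices (hence `h` preserves the metric). -/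
def IsSimplicialIsometry (X : AbstractSimplicialComplex V) (h : Equiv.Perm V) : Prop :=
  ∀ σ : Finset V, σ.map h.toEmbedding ∈ X ↔ σ ∈ X

/-- The translation length `|h|`, the minimum of the displacement `d(h(x), x)` over the vertices. -/
noncomputable def translationLength (X : AbstractSimplicialComplex V) (h : Equiv.Perm V) : ℕ :=
  ⨅ x : V, (skel X).dist (h x) x

/-- `σ` is an `h`-invariant simplex of `X` (not necessarily fixed pointwise). -/
def IsInvariantSimplex (X : AbstractSimplicialComplex V) (h : Equiv.Perm V) (σ : Finset V) : Prop :=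
  σ ∈ X ∧ σ.map h.toEmbedding = σ

/-- `h` is hyperbolic if it does not fix any simplex of `X`; otherwise it is elliptic. -/
def IsHyperbolic (X : AbstractSimplicialComplex V) (h : Equiv.Perm V) : Prop :=
  ¬ ∃ σ, IsInvariantSimplex X h σ

/-- The subcomplex `K` is mapped onto itself by `h`. -/
def IsInvariantSubcomplex (h : Equiv.Perm V) (K : PreAbstractSimplicialComplex V) : Prop :=
  ∀ σ : Finset V, σ.map h.toEmbedding ∈ K ↔ σ ∈ K

/-- A bi-infinite geodesic in the `1`-skeleton of `X`. -/
def IsGeodesicLine (X : AbstractSimplicialComplex V) (γ : ℤ → V) : Prop :=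
  ∀ m n : ℤ, ((skel X).dist (γ m) (γ n) : ℤ) = |m - n|

/-- A thick geodesic in `X`: the full subcomplex spanned by the union of a non-empty family of
bi-infinite geodesics that are uniformly parallel, i.e. whose mutual Hausdorff distances have a
common bound. -/
def IsThickGeodesic (X : AbstractSimplicialComplex V) (K : PreAbstractSimplicialComplex V) : Prop :=
  ∃ L : Set (ℤ → V), L.Nonempty ∧ (∀ γ ∈ L, IsGeodesicLine X γ) ∧
    (∃ C : ℕ, ∀ γ ∈ L, ∀ γ' ∈ L, ∀ n : ℤ, ∃ m : ℤ, (skel X).dist (γ n) (γ' m) ≤ C) ∧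
    K = fullSubcomplex X (⋃ γ ∈ L, Set.range γ)

end LocatedComplex

/-!
Since `|h| > 3`, no simplex is `h`-invariant, and an `h`-invariant thick geodesic has to be found.
It is the union of the translates of one geodesic line by the powers of `h`, and that line is
obtained as a limit of geodesic segments that stay close to an axis of `h`, that is, to the path
formed by the translates of a geodesic from a vertex `x` with `d(h x, x) = |h|` to its image.

The local input is as follows. The `SD'`-property makes `X` simply connected, so that every
chordless cycle of length from `4` to `8` lies in a ball of radius `1` (`fillsCycles`). Fix a base
vertex, and call a neighbour of `v` on the next lower sphere a parent of `v`. If a chordless path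
of length at most `4` rises above the sphere of its endpoints and can be closed up below this
sphere, then a single vertex of the sphere is adjacent to the whole path (`IsLayering.exists_cap`).
An induction on the level, in which parents of parents close up such paths, shows that parents
of vertices at flat distance at most `2` on a sphere are at flat distance at most `2` on the sphere
below (`IsLayering.parentsOfTwoSteps`). This has two consequences.

* Paths of length `4` with certain level patterns cannot be geodesics
  (`IsLayering.dist_le_three_of_peak`, `IsLayering.lt_lev_of_dist`). As all subpaths of length `4`
  of the axis `α` are geodesics, the axis moves away from `α 0`: it reaches the successive distances
  from `α 0` at times with gaps of at most `5` (`IsAxis.exists_firstTimes`). The case `|h| = 4` needs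
  an additional comparison of vertices with their images under `h`.
* Walks within a sphere contract by a factor `2 / 3`, up to a constant, when they are pushed down by
  one level (`IsLayering.flatWalk_par`). Hence the geodesics from `α 0` to the far vertices of the
  axis pass each sphere at a bounded distance from the first vertex of `α` on a slightly larger
  sphere (`IsAxis.flatWalk_ancestor`): they fellow-travel with the axis.

Translating the midpoints of these geodesics back to `α 0` and passing to a limit along an
ultrafilter, which exists by local finiteness, gives a geodesic line at finite Hausdorff distance
from the axis (`IsAxis.exists_isGeodesicLine`). Its translates by powers of `h` are as close to the
axis as the line itself, since `h` preserves the axis, so they are uniformly close to each other.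
-/

namespace LocatedComplex

universe u

variable {V : Type u} {X : AbstractSimplicialComplex V}

/-! ### Adjacency, simplices and the relation `Near` -/

theorem Near.refl (u : V) : Near X u u := Or.inl rfl

theorem Near.symm {u v : V} (h : Near X u v) : Near X v u :=
  h.elim (fun h => Or.inl h.symm) fun h => Or.inr h.symm

theorem near_of_mem {σ : Finset V} (hσ : σ ∈ X) {u v : V} (hu : u ∈ σ) (hv : v ∈ σ) :
    Near X u v := by
  by_cases h : u = v
  · exact Or.inl h
  · exact Or.inr ⟨h, σ, hσ, hu, hv⟩

theorem IsFlag.triple (hX : IsFlag X) {a b c : V} (hab : Near X a b) (hbc : Near X b c)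
    (hac : Near X a c) : ∃ σ ∈ X, a ∈ σ ∧ b ∈ σ ∧ c ∈ σ := by
  classical
  refine ⟨{a, b, c}, hX _ ⟨a, by simp⟩ ?_, by simp, by simp, by simp⟩
  intro u hu v hv huv
  have : Near X u v := by
    simp only [Finset.mem_insert, Finset.mem_singleton] at hu hv
    rcases hu with rfl | rfl | rfl <;> rcases hv with rfl | rfl | rfl <;>
      first | exact Near.refl _ | assumption | exact Near.symm (by assumption)
  exact this.resolve_left huv

theorem Near.dist_le {u v : V} (h : Near X u v) : (skel X).dist u v ≤ 1 := by
  rcases h with rfl | h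
  · simp
  · exact (SimpleGraph.dist_eq_one_iff_adj.2 h).le

theorem near_of_dist_le (hconn : (skel X).Connected) {u v : V} (h : (skel X).dist u v ≤ 1) :
    Near X u v := by
  rcases Nat.le_one_iff_eq_zero_or_eq_one.1 h with h | h
  · exact Or.inl (hconn.dist_eq_zero_iff.1 h)
  · exact Or.inr (SimpleGraph.dist_eq_one_iff_adj.1 h)

/-! ### Layers around a vertex -/

/-- `p` is a parent of `v` for the level function `lev`: a neighbour one level below `v`. -/
def Par (X : AbstractSimplicialComplex V) (lev : V → ℕ) (v p : V) : Prop :=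
  (skel X).Adj v p ∧ lev p + 1 = lev v

/-- The part of the `SD'`-property that concerns a fixed base vertex, written in terms of the
distance `lev` to that vertex: the triangle condition, the vertex condition, and the elementary
properties of a distance function. In contrast to `TriangleCondition` and `VertexCondition`, the
spheres of radius `1` are included, for which both conditions hold trivially. -/
structure IsLayering (X : AbstractSimplicialComplex V) (lev : V → ℕ) : Prop where
  le_succ : ∀ {u v}, Near X u v → lev u ≤ lev v + 1
  eq_of_zero : ∀ {u v}, lev u = 0 → lev v = 0 → u = v
  exists_par : ∀ {v}, 1 ≤ lev v → ∃ p, Par X lev v p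
  triangle : ∀ {u v}, Near X u v → lev u = lev v → 1 ≤ lev u → ∃ p, Par X lev u p ∧ Par X lev v p
  vertex : ∀ {v p q}, Par X lev v p → Par X lev v q → ∃ t, Par X lev v t ∧ Near X t p ∧ Near X t q

theorem exists_dist_pred (hconn : (skel X).Connected) (O : V) {v : V}
    (hv : 1 ≤ (skel X).dist O v) : ∃ p, Par X ((skel X).dist O) v p := by
  obtain ⟨w, hw⟩ := hconn.exists_walk_length_eq_dist v O
  cases w with
  | nil => simp at hv
  | @cons _ p _ hadj q =>
    refine ⟨p, hadj, ?_⟩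
    have h1 := SimpleGraph.dist_le q
    have h2 := hconn.dist_triangle (u := O) (v := p) (w := v)
    rw [SimpleGraph.dist_eq_one_iff_adj.2 hadj.symm] at h2
    rw [SimpleGraph.Walk.length_cons] at hw
    rw [SimpleGraph.dist_comm] at h1
    rw [SimpleGraph.dist_comm] at hw
    omega

theorem singleton_mem_link_ball {O v p : V} {i : ℕ} :
    ({p} : Finset V) ∈ link X {v} ⊓ ball X i O ↔
      (skel X).Adj v p ∧ (skel X).dist O p ≤ i := by
  constructor
  · rintro ⟨⟨-, hd, ρ, hρ, h1, h2⟩, -, h⟩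
    refine ⟨⟨?_, ρ, hρ, by simpa using h2, by simpa using h1⟩, by simpa using h⟩
    rintro rfl
    simp at hd
  · rintro ⟨⟨hne, ρ, hρ, h1, h2⟩, h⟩
    refine ⟨⟨by simp, by simpa using hne.symm, ρ, hρ, by simpa using h2, by simpa using h1⟩,
      X.singleton_mem p, by simpa using h⟩

theorem isLayering_dist (hconn : (skel X).Connected) (hX : IsFlag X) (hSD : SDPrime X) (O : V) :
    IsLayering X ((skel X).dist O) := by
  have hle : ∀ {u v}, Near X u v → (skel X).dist O u ≤ (skel X).dist O v + 1 := by
    intro u v huv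
    have := hconn.dist_triangle (u := O) (v := v) (w := u)
    have := huv.symm.dist_le
    omega
  have hzero : ∀ {u}, (skel X).dist O u = 0 → u = O := fun h =>
    (hconn.dist_eq_zero_iff.1 h).symm
  refine ⟨hle, fun h1 h2 => (hzero h1).trans (hzero h2).symm, exists_dist_pred hconn O, ?_, ?_⟩
  · intro u v huv he hpos
    rcases huv with rfl | huv
    · obtain ⟨p, hp⟩ := exists_dist_pred hconn O hpos
      exact ⟨p, hp, hp⟩
    · by_cases h1 : (skel X).dist O u = 1
      · refine ⟨O, ⟨(SimpleGraph.dist_eq_one_iff_adj.1 h1).symm, by simp [h1]⟩,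
          ⟨(SimpleGraph.dist_eq_one_iff_adj.1 (he ▸ h1)).symm, by simp [← he, h1]⟩⟩
      · obtain ⟨i, hi⟩ : ∃ i, (skel X).dist O u = i + 1 := ⟨_, (Nat.succ_pred_eq_of_pos hpos).symm⟩
        classical
        have hT := (hSD i O i (by simp; omega)).1 {u, v} ⟨hX _ ⟨u, by simp⟩ (by
          intro a ha b hb hab
          simp only [Finset.mem_insert, Finset.mem_singleton] at ha hb
          rcases ha with rfl | rfl <;> rcases hb with rfl | rfl <;>
            first | exact absurd rfl hab | assumption | exact SimpleGraph.Adj.symm (by assumption)),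
          by simp only [Finset.mem_insert, Finset.mem_singleton, forall_eq_or_imp, forall_eq]
             exact ⟨hi, he.symm.trans hi⟩⟩ (Finset.card_pair huv.1)
        obtain ⟨τ, ⟨⟨p, hp⟩, hd, ρ, hρ, h2, h3⟩, -, h4⟩ := hT
        have hpu : p ≠ u := fun h => Finset.disjoint_left.1 hd hp (by simp [h])
        have hpv : p ≠ v := fun h => Finset.disjoint_left.1 hd hp (by simp [h])
        have hu : (skel X).Adj u p := ⟨hpu.symm, ρ, hρ, h3 (by simp), h2 hp⟩
        have hv : (skel X).Adj v p := ⟨hpv.symm, ρ, hρ, h3 (by simp), h2 hp⟩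
        have h5 : (skel X).dist O p ≤ i := h4 p hp
        have h6 := hle (Or.inr hu)
        exact ⟨p, ⟨hu, by omega⟩, ⟨hv, by omega⟩⟩
  · intro v p q hp hq
    by_cases h1 : (skel X).dist O v = 1
    · have h2 : p = O := hzero (by have := hp.2; omega)
      have h3 : q = O := hzero (by have := hq.2; omega)
      subst h2 h3
      exact ⟨_, hp, Near.refl _, Near.refl _⟩
    · obtain ⟨i, hi⟩ : ∃ i, (skel X).dist O v = i + 1 := ⟨_, hp.2.symm⟩
      obtain ⟨t, ht, h⟩ := (hSD i O i (by simp; omega)).2 v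
        ⟨X.singleton_mem v, by simpa using hi⟩ p q
        ((singleton_mem_link_ball).2 ⟨hp.1, by have := hp.2; omega⟩)
        ((singleton_mem_link_ball).2 ⟨hq.1, by have := hq.2; omega⟩)
      obtain ⟨h2, h3⟩ := (singleton_mem_link_ball).1 ht
      have h6 := hle (Or.inr h2)
      exact ⟨t, ⟨h2, by omega⟩, h⟩

/-! ### Simple connectivity -/

/-- Homotopy of edge paths, given as lists of vertices. -/
def Htpy (X : AbstractSimplicialComplex V) : List V → List V → Prop :=
  Relation.EqvGen (EdgePathMove X)

theorem Htpy.refl (l : List V) : Htpy X l l := Relation.EqvGen.refl l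

theorem Htpy.symm {l l' : List V} (h : Htpy X l l') : Htpy X l' l := Relation.EqvGen.symm _ _ h

theorem Htpy.trans {l₁ l₂ l₃ : List V} (h : Htpy X l₁ l₂) (h' : Htpy X l₂ l₃) : Htpy X l₁ l₃ :=
  Relation.EqvGen.trans _ _ _ h h'

theorem Htpy.append {l l' : List V} (h : Htpy X l l') (q : List V) : Htpy X (l ++ q) (l' ++ q) := by
  induction h with
  | rel x y h =>
    refine Relation.EqvGen.rel _ _ ?_
    cases h with
    | short l₁ l₂ a b c h => simpa using EdgePathMove.short l₁ (l₂ ++ q) a b c h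
    | stat l₁ l₂ a => simpa using EdgePathMove.stat (X := X) l₁ (l₂ ++ q) a
  | refl x => exact Htpy.refl _
  | symm x y _ ih => exact ih.symm
  | trans x y z _ _ ih₁ ih₂ => exact ih₁.trans ih₂

theorem Htpy.short (hX : IsFlag X) (l : List V) {a b c : V} (hab : Near X a b) (hbc : Near X b c)
    (hac : Near X a c) : Htpy X (l ++ [a, b, c]) (l ++ [a, c]) := by
  simpa [Htpy] using Relation.EqvGen.rel _ _ (EdgePathMove.short l [] a b c (hX.triple hab hbc hac))

theorem Htpy.stat (l : List V) (a : V) : Htpy X (l ++ [a, a]) (l ++ [a]) := by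
  simpa [Htpy] using Relation.EqvGen.rel _ _ (EdgePathMove.stat (X := X) l [] a)

/-- `Ascent X lev l v` says that `l ++ [v]` is an edge path from a vertex of level `0` to `v` which
goes up by one level in each step. -/
inductive Ascent (X : AbstractSimplicialComplex V) (lev : V → ℕ) : List V → V → Prop
  | base {a : V} (h : lev a = 0) : Ascent X lev [] a
  | step {l : List V} {u v : V} (hl : Ascent X lev l u) (h : Par X lev v u) :
      Ascent X lev (l ++ [u]) v

theorem IsLayering.exists_ascent {lev : V → ℕ} (H : IsLayering X lev) (v : V) :
    ∃ l, Ascent X lev l v := by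
  induction hn : lev v generalizing v with
  | zero => exact ⟨[], .base hn⟩
  | succ n ih =>
    obtain ⟨p, hp⟩ := H.exists_par (v := v) (by omega)
    obtain ⟨l, hl⟩ := ih p (by have := hp.2; omega)
    exact ⟨_, hl.step hp⟩

theorem Par.near {lev : V → ℕ} {v p : V} (h : Par X lev v p) : Near X v p := Or.inr h.1

/-- If ascending paths to a vertex of level `n` are unique up to homotopy, then ascending paths to
the endpoints of an edge of level `n` are homotopic along that edge. -/
theorem IsLayering.htpy_flat_of_htpy {lev : V → ℕ} (H : IsLayering X lev) (hX : IsFlag X) {n : ℕ}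
    (hn : ∀ v l l', lev v = n → Ascent X lev l v → Ascent X lev l' v →
      Htpy X (l ++ [v]) (l' ++ [v]))
    {v w : V} (hv : lev v = n) (hw : lev w = n) (hvw : Near X v w) {l l' : List V}
    (hl : Ascent X lev l v) (hl' : Ascent X lev l' w) : Htpy X (l ++ [v, w]) (l' ++ [w]) := by
  rcases Nat.eq_zero_or_pos n with h0 | hpos
  · obtain rfl := H.eq_of_zero (hv.trans h0) (hw.trans h0)
    exact (Htpy.stat l v).trans (hn v _ _ hv hl hl')
  · obtain ⟨p, hpv, hpw⟩ := H.triangle hvw (hv.trans hw.symm) (hv ▸ hpos)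
    obtain ⟨l₀, hl₀⟩ := H.exists_ascent p
    have h1 := (hn v _ _ hv hl (hl₀.step hpv)).append [w]
    have h2 := Htpy.short hX l₀ hpv.near.symm hvw hpw.near.symm
    have h3 := hn w _ _ hw (hl₀.step hpw) hl'
    simp only [List.append_assoc, List.cons_append, List.nil_append] at h1 h3
    exact (h1.trans h2).trans h3

/-- Two ascending paths to the same vertex are homotopic: the vertex condition gives a third path
whose last step spans triangles with the last steps of both. -/
theorem IsLayering.htpy_of_ascent {lev : V → ℕ} (H : IsLayering X lev) (hX : IsFlag X) (n : ℕ) :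
    ∀ v l l', lev v = n → Ascent X lev l v → Ascent X lev l' v →
      Htpy X (l ++ [v]) (l' ++ [v]) := by
  induction n with
  | zero =>
    intro v l l' hv hl hl'
    cases hl with
    | step _ h => have := h.2; omega
    | base _ =>
      cases hl' with
      | step _ h => have := h.2; omega
      | base _ => exact Htpy.refl _
  | succ n ih =>
    intro v l l' hv hl hl'
    cases hl with
    | base h => omega
    | @step l₁ u _ hl₁ hu =>
    cases hl' with
    | base h => omega
    | @step l₂ w _ hl₂ hw =>
    obtain ⟨t, ht, htu, htw⟩ := H.vertex hu hw
    obtain ⟨l₃, hl₃⟩ := H.exists_ascent t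
    have key : ∀ {l₁ u}, Par X lev v u → Near X t u → Ascent X lev l₁ u →
        Htpy X (l₃ ++ [t, v]) (l₁ ++ [u] ++ [v]) := by
      intro l₁ u hu htu hl₁
      have h1 := (H.htpy_flat_of_htpy hX ih (by have := ht.2; omega) (by have := hu.2; omega) htu
        hl₃ hl₁).append [v]
      have h2 := Htpy.short hX l₃ htu hu.near.symm ht.near.symm
      simp only [List.append_assoc, List.cons_append, List.nil_append] at h1 ⊢
      exact h2.symm.trans h1
    exact (key hu htu hl₁).symm.trans (key hw htw hl₂)

/-- Every edge path is homotopic, relative to its endpoints, to a path through the base vertex that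
ascends to its end: each step of the path is absorbed into an ascending path. -/
theorem IsLayering.htpy_walk {lev : V → ℕ} (H : IsLayering X lev) (hX : IsFlag X) {u v : V}
    (p : (skel X).Walk u v) : ∀ {l l'}, Ascent X lev l u → Ascent X lev l' v →
      Htpy X (l ++ p.support) (l' ++ [v]) := by
  induction p with
  | nil => exact fun hl hl' => H.htpy_of_ascent hX _ _ _ _ rfl hl hl'
  | @cons u w v hadj p ih =>
    intro l l' hl hl'
    rw [SimpleGraph.Walk.support_cons]
    have h1 := H.le_succ (Or.inr hadj)
    have h2 := H.le_succ (Or.inr hadj.symm)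
    have hsplit : l ++ u :: p.support = l ++ [u] ++ p.support := by simp
    by_cases hup : lev u + 1 = lev w
    · rw [hsplit]
      exact ih (hl.step ⟨hadj.symm, hup⟩) hl'
    have hps : p.support = [w] ++ p.support.tail := p.cons_tail_support.symm
    obtain ⟨l'', hl''⟩ := H.exists_ascent w
    suffices h : Htpy X (l ++ [u, w]) (l'' ++ [w]) by
      have h3 := h.append p.support.tail
      simp only [List.append_assoc, List.cons_append, List.nil_append] at h3
      have h4 := ih hl'' hl'
      rw [hps] at h4 ⊢
      exact Htpy.trans (by simpa using h3) (by simpa using h4)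
    by_cases hflat : lev u = lev w
    · exact H.htpy_flat_of_htpy hX (H.htpy_of_ascent hX (lev w)) hflat rfl (Or.inr hadj) hl hl''
    · have hpar : Par X lev u w := ⟨hadj, by omega⟩
      have h3 := (H.htpy_of_ascent hX _ _ _ _ rfl hl (hl''.step hpar)).append [w]
      have h4 := Htpy.short hX l'' (Or.inr hadj.symm) (Or.inr hadj) (Near.refl w)
      simp only [List.append_assoc, List.cons_append, List.nil_append] at h3
      exact (h3.trans h4).trans (Htpy.stat _ _)

/-- A complex with the `SD'`-property is simply connected. -/
theorem homotopicallyTrivial_of_sdPrime (hconn : (skel X).Connected) (hX : IsFlag X)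
    (hSD : SDPrime X) {a : V} (γ : (skel X).Walk a a) : HomotopicallyTrivial X γ := by
  have H := isLayering_dist hconn hX hSD a
  have ha : Ascent X ((skel X).dist a) [] a := .base (by simp)
  simpa [HomotopicallyTrivial, Htpy] using H.htpy_walk hX γ ha ha

/-! ### Chordless cycles -/

/-- A list of vertices that is a chordless path: consecutive vertices are adjacent, other vertices
are distinct and not adjacent. -/
def InducedPath (X : AbstractSimplicialComplex V) : List V → Prop
  | [] => True
  | [_] => True
  | a :: b :: l => (skel X).Adj a b ∧ (∀ c ∈ l, ¬ Near X a c) ∧ InducedPath X (b :: l)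

theorem InducedPath.append {a b : V} (hab : (skel X).Adj a b) : ∀ {l : List V},
    InducedPath X (l ++ [a]) → (∀ x ∈ l, ¬ Near X x b) → InducedPath X (l ++ [a, b])
  | [], _, _ => ⟨hab, by simp, trivial⟩
  | [x], h, hx => ⟨h.1, by simpa using hx, hab, by simp, trivial⟩
  | x :: y :: l, h, hx => by
    refine ⟨h.1, ?_, InducedPath.append hab (l := y :: l) h.2.2
      fun z hz => hx z (List.mem_cons_of_mem x hz)⟩
    intro c (hc : c ∈ l ++ [a, b])
    simp only [List.mem_append, List.mem_cons, List.not_mem_nil, or_false] at hc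
    rcases hc with hc | rfl | rfl
    · exact h.2.1 c (List.mem_append_left _ hc)
    · exact h.2.1 c (List.mem_append_right _ (by simp))
    · exact hx x (by simp)

theorem InducedPath.nodup : ∀ {l : List V}, InducedPath X l → l.Nodup
  | [], _ => List.nodup_nil
  | [_], _ => List.nodup_singleton _
  | a :: b :: l, h => by
    refine List.nodup_cons.2 ⟨?_, InducedPath.nodup h.2.2⟩
    intro ha
    rcases List.mem_cons.1 ha with rfl | ha
    · exact h.1.ne rfl
    · exact h.2.1 a ha (Near.refl a)

theorem InducedPath.exists_walk {c : V} : ∀ {b : V} {m : List V}, InducedPath X (b :: (m ++ [c])) →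
    ∃ p : (skel X).Walk b c, p.support = b :: (m ++ [c])
  | b, [], h => ⟨SimpleGraph.Walk.cons h.1 .nil, rfl⟩
  | b, x :: m, h => by
    obtain ⟨p, hp⟩ := InducedPath.exists_walk (b := x) (m := m) h.2.2
    exact ⟨SimpleGraph.Walk.cons h.1 p, by simp [hp]⟩

/-- A set of pairwise near vertices of a chordless path is contained in an edge of the path or
consists of at most the last vertex; the second case covers the path without edges. -/
theorem InducedPath.exists_edge {b c : V} (p : (skel X).Walk b c) (hp : InducedPath X p.support)
    {σ : Finset V} (hσ : ∀ x ∈ σ, ∀ y ∈ σ, Near X x y) (hs : ∀ x ∈ σ, x ∈ p.support) :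
    (∃ e ∈ p.edges, ∀ x ∈ σ, x ∈ e) ∨ ∀ x ∈ σ, x = c := by
  induction p with
  | nil => exact Or.inr (by simpa using hs)
  | @cons u w v hadj p ih =>
    have hps : p.support = w :: p.support.tail := p.cons_tail_support.symm
    rw [SimpleGraph.Walk.support_cons, hps] at hp
    by_cases hu : u ∈ σ
    · refine Or.inl ⟨s(u, w), by simp, fun x hx => ?_⟩
      have h1 := hs x hx
      rw [SimpleGraph.Walk.support_cons, hps] at h1
      simp only [List.mem_cons] at h1
      rcases h1 with rfl | rfl | h1
      · simp
      · simp
      · exact absurd (hσ u hu x hx) (hp.2.1 x h1)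
    · have h2 : ∀ x ∈ σ, x ∈ p.support := fun x hx => by
        have h1 := hs x hx
        rw [SimpleGraph.Walk.support_cons] at h1
        exact (List.mem_cons.1 h1).resolve_left (fun h => hu (h ▸ hx))
      rcases ih (by rw [hps]; exact hp.2.2) h2 with ⟨e, he, h⟩ | h
      · exact Or.inl ⟨e, by simp [he], h⟩
      · exact Or.inr h

/-- Every chordless cycle of length from `4` to `8` lies in a ball of radius `1`. The cycle is given
by one of its vertices, `a`, and the chordless path from `b` to `c` through the other vertices. -/
def FillsCycles (X : AbstractSimplicialComplex V) : Prop :=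
  ∀ (a b c : V) (m : List V), m ≠ [] → m.length ≤ 5 → (skel X).Adj a b → (skel X).Adj a c →
    (∀ x ∈ m, ¬ Near X a x) → InducedPath X (b :: (m ++ [c])) →
    ∃ e, Near X e a ∧ ∀ x ∈ b :: (m ++ [c]), Near X e x

theorem InducedPath.not_near {c : V} {b : V} {m : List V} (hm : m ≠ [])
    (h : InducedPath X (b :: (m ++ [c]))) : ¬ Near X b c := by
  cases m with
  | nil => exact absurd rfl hm
  | cons x m => exact h.2.1 c (by simp)

theorem fillsCycles (hconn : (skel X).Connected) (hloc : IsLocated X 8) (hSD : SDPrime X) :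
    FillsCycles X := by
  intro a b c m hm hlen hab hac ham hind
  obtain ⟨p, hp⟩ := hind.exists_walk
  have hbc := hind.not_near hm
  have ha : a ∉ p.support := by
    rw [hp]
    simp only [List.mem_cons, List.mem_append, List.not_mem_nil, or_false, not_or]
    exact ⟨hab.ne, fun h => ham a h (Near.refl a), hac.ne⟩
  set γ : (skel X).Walk a a := SimpleGraph.Walk.cons hab (p.concat hac.symm) with hγ
  have hsupp : ∀ x, x ∈ γ.support ↔ x = a ∨ x ∈ p.support := by
    intro x
    simp [hγ, SimpleGraph.Walk.support_concat]
    tauto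
  have hcyc : γ.IsCycle := by
    rw [hγ, SimpleGraph.Walk.cons_isCycle_iff]
    constructor
    · rw [SimpleGraph.Walk.isPath_def, SimpleGraph.Walk.support_concat,
        List.nodup_append]
      refine ⟨hp ▸ hind.nodup, List.nodup_singleton _, ?_⟩
      rintro x hx y hy rfl
      exact ha (by simpa [List.mem_singleton.1 hy] using hx)
    · rw [SimpleGraph.Walk.edges_concat]
      simp only [List.concat_eq_append, List.mem_append, List.mem_singleton, not_or]
      refine ⟨fun h => ha (p.fst_mem_support_of_mem_edges h), fun h => ?_⟩
      rcases Sym2.eq_iff.1 h with ⟨h1, -⟩ | ⟨-, h1⟩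
      · exact hac.ne h1
      · exact hbc (Or.inl h1)
  have hfull : IsFullCycle X γ := by
    refine ⟨hcyc, fun σ hσ hs => ?_⟩
    have hnear : ∀ x ∈ σ, ∀ y ∈ σ, Near X x y := fun x hx y hy => near_of_mem hσ hx hy
    have hab_mem : s(a, b) ∈ γ.edges := by simp [hγ]
    have hca_mem : s(c, a) ∈ γ.edges := by simp [hγ, SimpleGraph.Walk.edges_concat]
    by_cases haσ : a ∈ σ
    · have h1 : ∀ x ∈ σ, x = a ∨ x = b ∨ x = c := by
        intro x hx
        rcases (hsupp x).1 (hs x hx) with h | h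
        · exact Or.inl h
        · rw [hp] at h
          simp only [List.mem_cons, List.mem_append, List.not_mem_nil, or_false] at h
          rcases h with h | h | h
          · exact Or.inr (Or.inl h)
          · exact absurd (hnear a haσ x hx) (ham x h)
          · exact Or.inr (Or.inr h)
      by_cases hb : b ∈ σ
      · refine ⟨_, hab_mem, fun x hx => ?_⟩
        rcases h1 x hx with rfl | rfl | rfl
        · simp
        · simp
        · exact absurd (hnear b hb x hx) hbc
      · refine ⟨_, hca_mem, fun x hx => ?_⟩
        rcases h1 x hx with rfl | rfl | rfl
        · simp
        · exact absurd hx hb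
        · simp
    · have h1 : ∀ x ∈ σ, x ∈ p.support := fun x hx =>
        ((hsupp x).1 (hs x hx)).resolve_left fun h => haσ (h ▸ hx)
      rcases InducedPath.exists_edge p (hp ▸ hind) hnear h1 with ⟨e, he, h⟩ | h
      · exact ⟨e, by simp [hγ, SimpleGraph.Walk.edges_concat, he], h⟩
      · exact ⟨_, hca_mem, fun x hx => by simp [h x hx]⟩
  have hl : γ.length ≤ 8 := by
    have h1 := congrArg List.length hp
    rw [SimpleGraph.Walk.length_support] at h1
    simp only [List.length_cons, List.length_append, List.length_nil] at h1
    rw [hγ, SimpleGraph.Walk.length_cons, SimpleGraph.Walk.length_concat]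
    omega
  obtain ⟨e, he⟩ := hloc.2 a γ hfull (homotopicallyTrivial_of_sdPrime hconn hloc.1 hSD γ) hl
  have he' : ∀ x ∈ γ.support, Near X e x := fun x hx =>
    near_of_dist_le hconn ((he x hx).2 x (by simp))
  exact ⟨e, he' a (by simp [hsupp]), fun x hx => he' x (by rw [hsupp, hp]; exact Or.inr hx)⟩

/-! ### Parents of nearby vertices on a sphere -/

/-- `a` and `b` lie on the same sphere, and a vertex of that sphere is near to both. -/
def FlatLinked (X : AbstractSimplicialComplex V) (lev : V → ℕ) (a b : V) : Prop :=
  ∃ e, lev e = lev a ∧ lev e = lev b ∧ Near X e a ∧ Near X e b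

/-- `a` and `b` have parents that are linked by a vertex of their sphere. -/
def ParentsLinked (X : AbstractSimplicialComplex V) (lev : V → ℕ) (a b : V) : Prop :=
  ∃ c d, Par X lev a c ∧ Par X lev b d ∧ FlatLinked X lev c d

/-- `a` and `b` have a common parent. -/
def ShareParent (X : AbstractSimplicialComplex V) (lev : V → ℕ) (a b : V) : Prop :=
  ∃ c, Par X lev a c ∧ Par X lev b c

/-- Two adjacent or equal steps along the sphere of radius `k` lead to vertices whose parents are
linked by a vertex of the sphere below. -/
def ParentsOfTwoSteps (X : AbstractSimplicialComplex V) (lev : V → ℕ) (k : ℕ) : Prop :=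
  ∀ u x w a b, lev u = k → lev x = k → lev w = k → Near X u x → Near X x w → Par X lev u a →
    Par X lev w b → FlatLinked X lev a b

section

variable {lev : V → ℕ}

theorem FlatLinked.symm {a b : V} (h : FlatLinked X lev a b) : FlatLinked X lev b a :=
  let ⟨e, h1, h2, h3, h4⟩ := h
  ⟨e, h2, h1, h4, h3⟩

theorem ParentsLinked.symm {a b : V} (h : ParentsLinked X lev a b) : ParentsLinked X lev b a :=
  let ⟨c, d, h1, h2, h3⟩ := h
  ⟨d, c, h2, h1, h3.symm⟩

theorem Near.flatLinked {a b : V} (h : Near X a b) (hl : lev a = lev b) : FlatLinked X lev a b :=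
  ⟨a, rfl, hl, Near.refl a, h⟩

theorem Near.par {v p : V} (h : Near X v p) (hl : lev p + 1 = lev v) : Par X lev v p :=
  ⟨h.resolve_left (by rintro rfl; omega), hl⟩

namespace IsLayering

variable (H : IsLayering X lev)
include H

theorem not_near {u v : V} (h : lev u + 1 < lev v) : ¬ Near X u v := fun hn => by
  have := H.le_succ hn.symm
  omega

theorem not_near' {u v : V} (h : lev u + 1 < lev v) : ¬ Near X v u := fun hn =>
  H.not_near h hn.symm

theorem flatLinked_of_par {v p q : V} (hp : Par X lev v p) (hq : Par X lev v q) :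
    FlatLinked X lev p q := by
  obtain ⟨t, ht, h1, h2⟩ := H.vertex hp hq
  have := ht.2
  have := hp.2
  have := hq.2
  exact ⟨t, by omega, by omega, h1, h2⟩

theorem shareParent_of_near {a b : V} (h : Near X a b) (hl : lev a = lev b) (hpos : 1 ≤ lev a) :
    ShareParent X lev a b :=
  H.triangle h hl hpos

theorem parentsLinked_of_flatLinked {a b : V} (h : FlatLinked X lev a b) (hpos : 1 ≤ lev a) :
    ParentsLinked X lev a b := by
  obtain ⟨e, h1, h2, h3, h4⟩ := h
  obtain ⟨c, hc, hc'⟩ := H.triangle h3 h1 (by omega)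
  obtain ⟨d, hd, hd'⟩ := H.triangle h4 h2 (by omega)
  exact ⟨c, d, hc', hd', H.flatLinked_of_par hc hd⟩

/-- If a chordless path that rises above the sphere of its endpoints can be closed up below that
sphere to a cycle of length at most `8`, then a vertex of the sphere is near to all its vertices. -/
theorem exists_cap (hF : FillsCycles X) {a b : V} {Y : List V} (hY : Y ≠ [])
    (hlen : Y.length ≤ 3) (hlev : lev a = lev b) (hYlev : ∀ y ∈ Y, lev a < lev y)
    (hind : InducedPath X (a :: (Y ++ [b]))) (hB : ParentsLinked X lev a b) :
    ∃ e, lev e = lev a ∧ lev e = lev b ∧ ∀ x ∈ a :: (Y ++ [b]), Near X e x := by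
  suffices h : ∃ e z, lev z + 1 = lev a ∧ Near X e z ∧ ∀ x ∈ a :: (Y ++ [b]), Near X e x by
    obtain ⟨e, z, h1, h2, h3⟩ := h
    obtain ⟨y, hy⟩ := List.exists_mem_of_ne_nil Y hY
    have h4 := H.le_succ h2
    have h5 := H.le_succ (h3 y (by simp [hy])).symm
    have h6 := hYlev y hy
    exact ⟨e, by omega, by omega, h3⟩
  have hab := hind.not_near hY
  have hlow : ∀ z, lev z + 1 = lev a → ∀ y ∈ Y, ¬ Near X z y := fun z hz y hy =>
    H.not_near (by have := hYlev y hy; omega)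
  obtain ⟨c, d, hc, hd, g, hg1, hg2, hgc, hgd⟩ := hB
  by_cases h1 : ShareParent X lev a b
  · obtain ⟨z, hza, hzb⟩ := h1
    obtain ⟨e, he, h⟩ := hF z a b Y hY (by omega) hza.1.symm hzb.1.symm (hlow z hza.2) hind
    exact ⟨e, z, hza.2, he, h⟩
  have hshare : ∀ z, Par X lev a z → ¬ Near X z b := fun z hz hzb =>
    h1 ⟨z, hz, hzb.symm.par (by have := hz.2; omega)⟩
  have hshare' : ∀ z, Par X lev b z → ¬ Near X z a := fun z hz hza =>
    h1 ⟨z, hza.symm.par (by have := hz.2; omega), hz⟩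
  have happ : ∀ d, Par X lev b d → InducedPath X (a :: (Y ++ [b]) ++ [d]) := by
    intro d hd
    have := InducedPath.append (l := a :: Y) hd.1 hind (by
      intro x hx
      rcases List.mem_cons.1 hx with rfl | hx
      · exact fun h => hshare' d hd h.symm
      · exact fun h => hlow d (by have := hd.2; omega) x hx h.symm)
    simpa using this
  by_cases h2 : ∃ c d, Par X lev a c ∧ Par X lev b d ∧ Near X c d
  · obtain ⟨c, d, hc, hd, hcd⟩ := h2
    have hne : c ≠ d := by
      rintro rfl
      exact h1 ⟨c, hc, hd⟩
    obtain ⟨e, he, h⟩ := hF c a d (Y ++ [b]) (by simp) (by simp; omega) hc.1.symm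
      (hcd.resolve_left hne) (by
        intro x hx
        rcases List.mem_append.1 hx with hx | hx
        · exact hlow c hc.2 x hx
        · rw [List.mem_singleton.1 hx]
          exact hshare c hc) (happ d hd)
    exact ⟨e, c, hc.2, he, fun x hx => h x (List.mem_append_left [d] hx)⟩
  · have hgz : lev g + 1 = lev a := hc.2 ▸ by omega
    have hga : ¬ Near X g a := fun h => h2 ⟨g, d, h.symm.par hgz, hd, hgd⟩
    have hgb : ¬ Near X g b := fun h => h2 ⟨c, g, hc, h.symm.par (by omega), hgc.symm⟩
    have hgc' : g ≠ c := by
      rintro rfl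
      exact hga (Or.inr hc.1.symm)
    have hgd' : g ≠ d := by
      rintro rfl
      exact hgb (Or.inr hd.1.symm)
    obtain ⟨e, he, h⟩ := hF g c d (a :: (Y ++ [b])) (by simp) (by simp; omega)
      (hgc.resolve_left hgc') (hgd.resolve_left hgd') (by
        intro x hx
        simp only [List.mem_cons, List.mem_append, List.not_mem_nil, or_false] at hx
        rcases hx with rfl | hx | rfl
        · exact hga
        · exact hlow g hgz x hx
        · exact hgb) ⟨hc.1.symm, by
        intro x hx
        replace hx : x ∈ Y ++ [b] ++ [d] := hx
        simp only [List.mem_append, List.mem_singleton] at hx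
        rcases hx with (hx | rfl) | rfl
        · exact hlow c hc.2 x hx
        · exact hshare c hc
        · exact fun h => h2 ⟨c, x, hc, hd, h⟩, happ d hd⟩
    exact ⟨e, g, hgz, he, fun x hx => h x (List.mem_cons_of_mem _ (List.mem_append_left [d] hx))⟩

/-- Let `v, u, s` and `v, w, t` be descending paths with `u` and `w` not near. Then `s` and `t` are
near, or one of them is a parent of both `u` and `w`. Otherwise the path from `s` through `v` to `t`
could be capped by a vertex on the sphere of `s`, which is too far from `v`. -/
theorem near_of_grandparents (hF : FillsCycles X) {k : ℕ} (hN : ParentsOfTwoSteps X lev k)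
    {v u w s t : V} (hk : lev u = k) (hu : Par X lev v u) (hw : Par X lev v w)
    (huw : ¬ Near X u w) (hs : Par X lev u s) (ht : Par X lev w t) :
    Near X s t ∨ Near X u t ∨ Near X w s := by
  by_contra! hcon
  obtain ⟨hst, hut, hws⟩ := hcon
  obtain ⟨x, hx, hxu, hxw⟩ := H.vertex hu hw
  have h1 := hu.2
  have h2 := hw.2
  have h3 := hs.2
  have h4 := ht.2
  have h5 := hx.2
  have hFL := hN u x w s t hk (by omega) (by omega) hxu.symm hxw hs ht
  have hpos : 1 ≤ lev s := by
    by_contra h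
    exact hst (Or.inl (H.eq_of_zero (by omega) (by omega)))
  obtain ⟨e, he1, he2, he⟩ := H.exists_cap hF (a := s) (b := t) (Y := [u, v, w]) (by simp)
    (by simp) (by omega) (by simp; omega)
    (by
      simp only [InducedPath, List.cons_append, List.nil_append, List.mem_cons, List.not_mem_nil,
        or_false, forall_eq_or_imp, forall_eq, and_true, IsEmpty.forall_iff, implies_true]
      exact ⟨hs.1.symm, ⟨H.not_near (by omega), fun h => hws h.symm, hst⟩, hu.1.symm,
        ⟨huw, hut⟩, hw.1, H.not_near' (by omega), ht.1⟩)
    (H.parentsLinked_of_flatLinked hFL hpos)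
  have := H.le_succ (he v (by simp)).symm
  omega

/-- Two parents `u` and `w` of a vertex have a common parent, or all parents of `u` are near to all
parents of `w`. -/
theorem shareParent_or (hF : FillsCycles X) {k : ℕ} (hN : ParentsOfTwoSteps X lev k)
    {v u w : V} (hk : lev u = k) (hpos : 1 ≤ lev u) (hu : Par X lev v u) (hw : Par X lev v w) :
    ShareParent X lev u w ∨ ∀ s t, Par X lev u s → Par X lev w t → Near X s t := by
  have h1 := hu.2
  have h2 := hw.2
  by_cases huw : Near X u w
  · exact Or.inl (H.shareParent_of_near huw (by omega) hpos)
  by_cases hsh : ShareParent X lev u w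
  · exact Or.inl hsh
  refine Or.inr fun s t hs ht => ?_
  have h3 := hs.2
  have h4 := ht.2
  rcases H.near_of_grandparents hF hN hk hu hw huw hs ht with h | h | h
  · exact h
  · exact absurd ⟨t, h.par (by omega), ht⟩ hsh
  · exact absurd ⟨s, hs, h.par (by omega)⟩ hsh

/-- Parents `a`, `b` of adjacent vertices `u`, `w` of a sphere are linked: the path `a, u, w, b` is
closed up below through a common parent of `u` and `w`, and then capped. -/
theorem flatLinked_of_near (hF : FillsCycles X) {k : ℕ} (hN : ParentsOfTwoSteps X lev k)
    {u w a b : V} (hu : lev u = k + 1) (hw : lev w = k + 1) (huw : Near X u w)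
    (ha : Par X lev u a) (hb : Par X lev w b) : FlatLinked X lev a b := by
  by_contra hFL
  have h1 := ha.2
  have h2 := hb.2
  have hpos : 1 ≤ lev a := by
    by_contra h
    exact hFL (Near.flatLinked (Or.inl (H.eq_of_zero (by omega) (by omega))) (by omega))
  have hne : u ≠ w := by
    rintro rfl
    exact hFL (H.flatLinked_of_par ha hb)
  obtain ⟨p, hpu, hpw⟩ := H.triangle huw (by omega) (by omega)
  have h3 := hpu.2
  have hB : ParentsLinked X lev a b := by
    rcases H.shareParent_or hF hN (by omega) hpos ha hpu with ⟨c, hca, hcp⟩ | hac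
    · rcases H.shareParent_or hF hN (by omega) (by omega) hpw hb with ⟨d, hdp, hdb⟩ | hbd
      · exact ⟨c, d, hca, hdb, H.flatLinked_of_par hcp hdp⟩
      · obtain ⟨d, hd⟩ := H.exists_par (v := b) (by omega)
        have := hca.2
        have := hd.2
        exact ⟨c, d, hca, hd, (hbd c d hcp hd).flatLinked (by omega)⟩
    · obtain ⟨c, hc⟩ := H.exists_par hpos
      have := hc.2
      rcases H.shareParent_or hF hN (by omega) (by omega) hpw hb with ⟨d, hdp, hdb⟩ | hbd
      · have := hdb.2
        exact ⟨c, d, hc, hdb, (hac c d hc hdp).flatLinked (by omega)⟩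
      · obtain ⟨d, hd⟩ := H.exists_par (v := b) (by omega)
        obtain ⟨g, hg⟩ := H.exists_par (v := p) (by omega)
        have := hd.2
        have := hg.2
        exact ⟨c, d, hc, hd, g, by omega, by omega, (hac c g hc hg).symm, hbd g d hg hd⟩
  obtain ⟨e, he1, he2, he⟩ := H.exists_cap hF (a := a) (b := b) (Y := [u, w]) (by simp)
    (by simp) (by omega) (by simp; omega)
    (by
      simp only [InducedPath, List.cons_append, List.nil_append, List.mem_cons, List.not_mem_nil,
        or_false, forall_eq_or_imp, forall_eq, and_true, IsEmpty.forall_iff, implies_true]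
      exact ⟨ha.1.symm,
        ⟨fun h => hFL (H.flatLinked_of_par (h.symm.par (by omega)) hb),
          fun h => hFL (h.flatLinked (by omega))⟩, huw.resolve_left hne,
        fun h => hFL (H.flatLinked_of_par ha (h.par (by omega))), hb.1⟩) hB
  exact hFL ⟨e, he1, he2, he a (by simp), he b (by simp)⟩

theorem parentsLinked_of_shareParent (hF : FillsCycles X) {k : ℕ}
    (hN : ParentsOfTwoSteps X lev k) {x w p a b : V} (hx : lev x = k + 1) (hw : lev w = k + 1)
    (hxw : Near X x w) (hp : Par X lev x p) (hb : Par X lev w b) (hb1 : 1 ≤ lev b)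
    (hap : ShareParent X lev a p) : ParentsLinked X lev a b := by
  obtain ⟨c, hca, hcp⟩ := hap
  obtain ⟨e, he1, he2, hep, heb⟩ := H.flatLinked_of_near hF hN hx hw hxw hp hb
  obtain ⟨d, hd⟩ := H.exists_par hb1
  have := hp.2
  exact ⟨c, d, hca, hd, hN p e b c d (by omega) (by omega) (by omega) hep.symm heb hcp hd⟩

/-- The inductive step: the path `a, u, x, w, b` is closed up below through parents of `x`, and
then capped. -/
theorem parentsOfTwoSteps_succ (hF : FillsCycles X) {k : ℕ} (hN : ParentsOfTwoSteps X lev k) :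
    ParentsOfTwoSteps X lev (k + 1) := by
  intro u x w a b hu hx hw hux hxw ha hb
  by_contra hFL
  have h1 := ha.2
  have h2 := hb.2
  have hpos : 1 ≤ lev a := by
    by_contra h
    exact hFL (Near.flatLinked (Or.inl (H.eq_of_zero (by omega) (by omega))) (by omega))
  have huw : ¬ Near X u w := fun h => hFL (H.flatLinked_of_near hF hN hu hw h ha hb)
  have hux' : (skel X).Adj u x := hux.resolve_left (by rintro rfl; exact huw hxw)
  have hxw' : (skel X).Adj x w := hxw.resolve_left (by rintro rfl; exact huw hux)
  have hab : ¬ Near X a b := fun h => hFL (h.flatLinked (by omega))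
  have hub : ¬ Near X u b := fun h => hFL (H.flatLinked_of_par ha (h.par (by omega)))
  have haw : ¬ Near X a w := fun h => hFL (H.flatLinked_of_par (h.symm.par (by omega)) hb)
  have hax : ¬ Near X a x := fun h =>
    hFL (H.flatLinked_of_near hF hN hx hw hxw (h.symm.par (by omega)) hb)
  have hxb : ¬ Near X x b := fun h =>
    hFL (H.flatLinked_of_near hF hN hu hx hux ha (h.par (by omega)))
  -- a parent of `x` that shares a parent with `a` or with `b` already gives the bottom of the cycle
  have key₁ : ∀ p, Par X lev x p → ShareParent X lev a p → ParentsLinked X lev a b :=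
    fun p hp hap => H.parentsLinked_of_shareParent hF hN hx hw hxw hp hb (by omega) hap
  have key₂ : ∀ p, Par X lev x p → ShareParent X lev b p → ParentsLinked X lev a b :=
    fun p hp hbp =>
      (H.parentsLinked_of_shareParent hF hN hx hu hux.symm hp ha (by omega) hbp).symm
  have hB : ParentsLinked X lev a b := by
    obtain ⟨p, hpu, hpx⟩ := H.triangle hux (by omega) (by omega)
    obtain ⟨q, hqx, hqw⟩ := H.triangle hxw (by omega) (by omega)
    have h3 := hpu.2
    have h4 := hqx.2
    obtain ⟨c, hc⟩ := H.exists_par hpos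
    obtain ⟨d, hd⟩ := H.exists_par (v := b) (by omega)
    have h5 := hc.2
    have h6 := hd.2
    rcases H.shareParent_or hF hN (by omega) hpos ha hpu with hs | hap
    · exact key₁ p hpx hs
    rcases H.shareParent_or hF hN (by omega) (by omega) hb hqw with hs | hbq
    · exact key₂ q hqx hs
    obtain ⟨e, hex, hep, heq⟩ := H.vertex hpx hqx
    have h7 := hex.2
    obtain ⟨g, hge, hgp⟩ := H.triangle hep (by omega) (by omega)
    obtain ⟨g', hge', hgq⟩ := H.triangle heq (by omega) (by omega)
    have h8 := hge.2
    have h8' := hge'.2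
    by_cases hae : ShareParent X lev a e
    · exact key₁ e hex hae
    have hcg : Near X c g := hap c g hc hgp
    by_cases hue : Near X u e
    · rcases H.shareParent_or hF hN (by omega) hpos ha (hue.par (by omega)) with hs | hae'
      · exact absurd hs hae
      · exact ⟨c, d, hc, hd, g', by omega, by omega, (hae' c g' hc hge').symm,
          (hbq d g' hd hgq).symm⟩
    have hag : ¬ Near X a g := fun h => hae ⟨g, h.par (by omega), hge⟩
    have hec : ¬ Near X e c := fun h => hae ⟨c, hc, h.par (by omega)⟩
    -- otherwise `a`, `u`, `x`, `e`, `g`, `c` is a chordless hexagon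
    obtain ⟨f, hfa, hf⟩ := hF a u c [x, e, g] (by simp) (by simp) ha.1.symm hc.1
      (by
        simp only [List.mem_cons, List.not_mem_nil, or_false, forall_eq_or_imp, forall_eq]
        exact ⟨hax, fun h => hae (H.shareParent_of_near h (by omega) hpos), hag⟩)
      (by
        simp only [InducedPath, List.cons_append, List.nil_append, List.mem_cons,
          List.not_mem_nil, or_false, forall_eq_or_imp, forall_eq, and_true, IsEmpty.forall_iff,
          implies_true]
        exact ⟨hux', ⟨hue, H.not_near' (by omega), H.not_near' (by omega)⟩, hex.1,
          ⟨H.not_near' (by omega), H.not_near' (by omega)⟩, hge.1, hec,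
          hcg.symm.resolve_left (by rintro rfl; exact hag (Or.inr hc.1))⟩)
    have h9 := H.le_succ (hf g (by simp))
    have h10 := H.le_succ (hf u (by simp)).symm
    exact key₁ f ((hf x (by simp)).symm.par (by omega))
      (H.shareParent_of_near hfa.symm (by omega) hpos)
  obtain ⟨e, he1, he2, he⟩ := H.exists_cap hF (a := a) (b := b) (Y := [u, x, w]) (by simp)
    (by simp) (by omega) (by simp; omega)
    (by
      simp only [InducedPath, List.cons_append, List.nil_append, List.mem_cons, List.not_mem_nil,
        or_false, forall_eq_or_imp, forall_eq, and_true, IsEmpty.forall_iff, implies_true]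
      exact ⟨ha.1.symm, ⟨hax, haw, hab⟩, hux', ⟨huw, hub⟩, hxw', hxb, hb.1⟩) hB
  exact hFL ⟨e, he1, he2, he a (by simp), he b (by simp)⟩

theorem parentsOfTwoSteps (hF : FillsCycles X) (k : ℕ) : ParentsOfTwoSteps X lev k := by
  induction k with
  | zero =>
    intro u x w a b hu _ _ _ _ ha _
    have := ha.2
    omega
  | succ k ih => exact H.parentsOfTwoSteps_succ hF ih

theorem flatLinked_of_two_steps (hF : FillsCycles X) {u x w a b : V} (hux : Near X u x)
    (hxw : Near X x w) (h1 : lev u = lev x) (h2 : lev x = lev w) (ha : Par X lev u a)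
    (hb : Par X lev w b) : FlatLinked X lev a b :=
  H.parentsOfTwoSteps hF (lev x) u x w a b h1 rfl h2.symm hux hxw ha hb

end IsLayering

/-! ### Geodesics of length four relative to the layers -/

theorem dist_le_three (hconn : (skel X).Connected) {x a b y : V} (h1 : Near X x a)
    (h2 : Near X a b) (h3 : Near X b y) : (skel X).dist x y ≤ 3 := by
  have := hconn.dist_triangle (u := x) (v := a) (w := y)
  have := hconn.dist_triangle (u := a) (v := b) (w := y)
  have := h1.dist_le
  have := h2.dist_le
  have := h3.dist_le
  omega

namespace IsLayering

variable (H : IsLayering X lev)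
include H

/-- A path of length four that peaks at its middle vertex is not a geodesic, provided that its
ends do not rise above their neighbours on the path. -/
theorem dist_le_three_of_peak (hconn : (skel X).Connected) (hF : FillsCycles X)
    {x₀ x₁ x₂ x₃ x₄ : V} (h01 : Near X x₀ x₁) (h1 : Par X lev x₂ x₁) (h3 : Par X lev x₂ x₃)
    (h34 : Near X x₃ x₄) (hl0 : lev x₀ ≤ lev x₁) (hl4 : lev x₄ ≤ lev x₃) :
    (skel X).dist x₀ x₄ ≤ 3 := by
  by_cases h13 : Near X x₁ x₃
  · exact dist_le_three hconn h01 h13 h34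
  have e1 := h1.2
  have e3 := h3.2
  have hpos : 1 ≤ lev x₁ := by
    by_contra h
    exact h13 (Or.inl (H.eq_of_zero (by omega) (by omega)))
  have key : ∀ {x y}, Near X x y → lev x ≤ lev y → 1 ≤ lev y → ∃ s, Par X lev y s ∧ Near X x s := by
    intro x y hxy hle hy
    by_cases h : lev x = lev y
    · obtain ⟨s, hs, hs'⟩ := H.triangle hxy h (by omega)
      exact ⟨s, hs', hs.near⟩
    · have := H.le_succ hxy.symm
      exact ⟨x, hxy.symm.par (by omega), Near.refl x⟩
  obtain ⟨s, hs, hs0⟩ := key h01 hl0 hpos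
  obtain ⟨t, ht, ht4⟩ := key h34.symm hl4 (by omega)
  rcases H.near_of_grandparents hF (H.parentsOfTwoSteps hF _) rfl h1 h3 h13 hs ht with h | h | h
  · exact dist_le_three hconn hs0 h ht4.symm
  · exact dist_le_three hconn h01 h ht4.symm
  · exact dist_le_three hconn hs0 h.symm h34

/-- A geodesic of length four which goes up in its first step and not down in its second step ends
above the level reached after the first step. -/
theorem lt_lev_of_dist (hconn : (skel X).Connected) (hF : FillsCycles X)
    {x₀ x₁ x₂ x₃ x₄ : V} (h0 : Par X lev x₁ x₀) (h12 : Near X x₁ x₂) (h23 : Near X x₂ x₃)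
    (h34 : Near X x₃ x₄) (hl2 : lev x₁ ≤ lev x₂) (hd : 3 < (skel X).dist x₀ x₄) :
    lev x₁ < lev x₄ := by
  by_contra! hl4
  refine absurd hd (not_lt.2 ?_)
  have e0 := h0.2
  have a12 := H.le_succ h12.symm
  have a23 := H.le_succ h23
  have a23' := H.le_succ h23.symm
  have a34 := H.le_succ h34
  have key : ∀ {x y z}, Near X x₁ x → Near X x y → lev x₁ = lev x → lev x = lev y →
      Par X lev y z → Near X z x₄ → (skel X).dist x₀ x₄ ≤ 3 := by
    intro x y z h1 h2 e1 e2 hz hz4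
    obtain ⟨e, -, -, he0, hez⟩ := H.flatLinked_of_two_steps hF h1 h2 e1 e2 h0 hz
    exact dist_le_three hconn he0.symm hez hz4
  by_cases hl2' : lev x₂ = lev x₁
  · by_cases hx3 : lev x₃ + 1 = lev x₁
    · exact key h12 (Near.refl _) (by omega) rfl (h23.par (by omega)) h34
    by_cases hx3' : lev x₃ = lev x₁
    · by_cases hx4 : lev x₄ = lev x₃
      · obtain ⟨q, hq, hq'⟩ := H.triangle h34 hx4.symm (by omega)
        exact key h12 h23 (by omega) (by omega) hq hq'.near.symm
      · exact key h12 h23 (by omega) (by omega) (h34.par (by omega)) (Near.refl _)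
    · obtain ⟨t, ht, ht2, ht4⟩ := H.vertex (h23.symm.par (lev := lev) (by omega))
        (h34.par (lev := lev) (by omega))
      have et := ht.2
      obtain ⟨q, hq, hq'⟩ := H.triangle ht4 (by omega) (by omega)
      exact key h12 ht2.symm (by omega) (by omega) hq hq'.near.symm
  · have hl2'' : lev x₂ = lev x₁ + 1 := by omega
    by_cases hx3 : lev x₃ = lev x₁
    · obtain ⟨t, ht, ht1, ht3⟩ := H.vertex (h12.symm.par (lev := lev) (by omega))
        (h23.par (lev := lev) (by omega))
      have et := ht.2
      by_cases hx4 : lev x₄ = lev x₃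
      · obtain ⟨q, hq, hq'⟩ := H.triangle h34 hx4.symm (by omega)
        exact key ht1.symm ht3 (by omega) (by omega) hq hq'.near.symm
      · exact key ht1.symm ht3 (by omega) (by omega) (h34.par (by omega)) (Near.refl _)
    · obtain ⟨e, -, -, h1, h4⟩ := H.flatLinked_of_two_steps hF h23 (Near.refl _) (by omega) rfl
        (h12.symm.par (by omega)) (h34.par (by omega))
      exact dist_le_three hconn (Or.inr h0.1.symm) h1.symm h4

end IsLayering

end

/-! ### Simplicial isometries and their axes -/

section

variable {h : Equiv.Perm V}

theorem IsSimplicialIsometry.symm (hh : IsSimplicialIsometry X h) :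
    IsSimplicialIsometry X h.symm := fun σ => by
  have := hh (σ.map h.symm.toEmbedding)
  rw [Finset.map_map] at this
  simpa using this.symm

theorem IsSimplicialIsometry.adj (hh : IsSimplicialIsometry X h) {u v : V}
    (huv : (skel X).Adj u v) : (skel X).Adj (h u) (h v) := by
  obtain ⟨hne, σ, hσ, hu, hv⟩ := huv
  exact ⟨h.injective.ne hne, σ.map h.toEmbedding, (hh σ).2 hσ, by simpa using hu, by simpa using hv⟩

theorem IsSimplicialIsometry.near (hh : IsSimplicialIsometry X h) {u v : V}
    (huv : Near X u v) : Near X (h u) (h v) :=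
  huv.imp (congrArg h) hh.adj

theorem IsSimplicialIsometry.dist_le (hh : IsSimplicialIsometry X h)
    (hconn : (skel X).Connected) (u v : V) :
    (skel X).dist (h u) (h v) ≤ (skel X).dist u v := by
  obtain ⟨w, hw⟩ := hconn.exists_walk_length_eq_dist u v
  rw [← hw, ← SimpleGraph.Walk.length_map ⟨h, hh.adj⟩ w]
  exact SimpleGraph.dist_le _

theorem IsSimplicialIsometry.dist_eq (hh : IsSimplicialIsometry X h)
    (hconn : (skel X).Connected) (u v : V) :
    (skel X).dist (h u) (h v) = (skel X).dist u v :=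
  le_antisymm (hh.dist_le hconn u v) (by simpa using hh.symm.dist_le hconn (h u) (h v))

theorem IsSimplicialIsometry.zpow (hh : IsSimplicialIsometry X h) (n : ℤ) :
    IsSimplicialIsometry X (h ^ n) := by
  have hmul : ∀ {g g' : Equiv.Perm V}, IsSimplicialIsometry X g → IsSimplicialIsometry X g' →
      IsSimplicialIsometry X (g * g') := fun {g g'} hg hg' σ => by
    rw [← hg' σ, ← hg (σ.map g'.toEmbedding), Finset.map_map]
    rfl
  have hone : IsSimplicialIsometry X (1 : Equiv.Perm V) := fun σ => by
    have : Function.Embedding.refl V = (1 : Equiv.Perm V).toEmbedding := rfl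
    rw [← this, Finset.map_refl]
  induction n with
  | zero => simpa using hone
  | succ n ih => rw [zpow_add_one]; exact hmul ih hh
  | pred n ih => rw [zpow_sub_one]; exact hmul ih hh.symm

/-- An axis of `h`: a bi-infinite edge path on which `h` acts as the translation by its translation
length `L`, where `L` is at least `4`. Such a path need not be a geodesic. -/
structure IsAxis (X : AbstractSimplicialComplex V) (h : Equiv.Perm V) (L : ℕ) (α : ℤ → V) :
    Prop where
  four_le : 4 ≤ L
  near_succ : ∀ t, Near X (α t) (α (t + 1))
  map_eq : ∀ t, h (α t) = α (t + L)
  le_dist : ∀ z, L ≤ (skel X).dist (h z) z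

theorem exists_isAxis (hconn : (skel X).Connected) (hh : IsSimplicialIsometry X h)
    (hlen : 3 < translationLength X h) : ∃ α, IsAxis X h (translationLength X h) α := by
  have hne := hconn.nonempty
  set L := translationLength X h with hL
  have hle : ∀ z, L ≤ (skel X).dist (h z) z := fun z => ciInf_le (OrderBot.bddBelow _) z
  obtain ⟨x, hx⟩ := ciInf_mem fun x : V => (skel X).dist (h x) x
  replace hx : (skel X).dist x (h x) = L := by
    rw [SimpleGraph.dist_comm]
    exact hx
  obtain ⟨w, hw⟩ := hconn.exists_walk_length_eq_dist x (h x)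
  rw [hx] at hw
  have hLpos : (0 : ℤ) < L := by omega
  refine ⟨fun t => (h ^ (t / L)) (w.getVert (t % L).toNat), hlen, fun t => ?_, fun t => ?_, hle⟩
  · have h0 := Int.emod_nonneg t hLpos.ne'
    have h1 := Int.emod_lt_of_pos t hLpos
    have h2 : (skel X).Adj (w.getVert (t % L).toNat) (w.getVert ((t % L).toNat + 1)) :=
      w.adj_getVert_succ (by omega)
    have h3 := (hh.zpow (t / L)).near (Or.inr h2)
    have h4 := Int.emod_add_mul_ediv t L
    by_cases h5 : t % L + 1 < L
    · have h6 : (t + 1) / L = t / L ∧ (t + 1) % L = t % L + 1 :=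
        (Int.ediv_emod_unique hLpos).2 ⟨by linarith, by omega, h5⟩
      rw [h6.1, h6.2, Int.toNat_add h0 (by omega)]
      exact h3
    · have h6 : (t + 1) / L = t / L + 1 ∧ (t + 1) % L = 0 :=
        (Int.ediv_emod_unique hLpos).2 ⟨by linarith, by omega, hLpos⟩
      have h7 : (t % L).toNat + 1 = w.length := by omega
      rw [h7, w.getVert_length] at h3
      rw [h6.1, h6.2, zpow_add_one]
      simpa using h3
  · have h6 : (t + L) / L = t / L + 1 ∧ (t + L) % L = t % L :=
      (Int.ediv_emod_unique hLpos).2 ⟨by linarith [Int.emod_add_mul_ediv t L],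
        Int.emod_nonneg t hLpos.ne', Int.emod_lt_of_pos t hLpos⟩
    rw [h6.1, h6.2, add_comm (t / (L : ℤ)), zpow_one_add]
    rfl

namespace IsAxis

variable {L : ℕ} {α : ℤ → V} (A : IsAxis X h L α)
include A

theorem dist_add_le (hconn : (skel X).Connected) (t : ℤ) (j : ℕ) :
    (skel X).dist (α t) (α (t + j)) ≤ j := by
  induction j with
  | zero => simp
  | succ j ih =>
    have h1 := hconn.dist_triangle (u := α t) (v := α (t + j)) (w := α (t + (j + 1 : ℕ)))
    have h2 := (A.near_succ (t + j)).dist_le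
    rw [Nat.cast_succ, ← add_assoc] at h1 ⊢
    omega

theorem dist_le_natAbs (hconn : (skel X).Connected) (s t : ℤ) :
    (skel X).dist (α s) (α t) ≤ (t - s).natAbs := by
  rcases le_total s t with hst | hst
  · have h1 := A.dist_add_le hconn s (t - s).natAbs
    rwa [show s + ((t - s).natAbs : ℤ) = t by omega] at h1
  · have h1 := A.dist_add_le hconn t (t - s).natAbs
    rwa [show t + ((t - s).natAbs : ℤ) = s by omega, SimpleGraph.dist_comm] at h1

theorem dist_add (hconn : (skel X).Connected) (t : ℤ) {j : ℕ} (hj : j ≤ L) :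
    (skel X).dist (α t) (α (t + j)) = j := by
  refine le_antisymm (A.dist_add_le hconn t j) ?_
  have h1 := A.le_dist (α t)
  rw [A.map_eq, SimpleGraph.dist_comm] at h1
  have h2 := hconn.dist_triangle (u := α t) (v := α (t + j)) (w := α (t + L))
  have h3 := A.dist_add_le hconn (t + j) (L - j)
  rw [Nat.cast_sub hj, show t + (j : ℤ) + ((L : ℤ) - j) = t + L by ring] at h3
  omega

theorem symm_apply (t : ℤ) : h.symm (α t) = α (t - L) := by
  rw [Equiv.symm_apply_eq, A.map_eq]
  congr 1
  ring

theorem le_dist_symm (z : V) : L ≤ (skel X).dist (h.symm z) z := by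
  have := A.le_dist (h.symm z)
  rwa [Equiv.apply_symm_apply, SimpleGraph.dist_comm] at this

theorem zpow_apply (n t : ℤ) : (h ^ n) (α t) = α (t + n * L) := by
  induction n with
  | zero => simp
  | succ n ih => rw [add_comm (n : ℤ), zpow_one_add, Equiv.Perm.mul_apply, ih, A.map_eq]; congr 1; ring
  | pred n ih =>
    rw [sub_eq_neg_add, zpow_add, Equiv.Perm.mul_apply, ih, zpow_neg_one]
    refine (A.symm_apply _).trans ?_
    congr 1
    ring

end IsAxis

end

/-! ### Linear growth along an axis -/

/-- `t` is the first time, counted from `-2`, at which the path `α` reaches distance `k` from its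
vertex `α 0`, and `t` is at least `4`, so that `t - 6` is in the range where this is known. -/
structure IsFirstTime (X : AbstractSimplicialComplex V) (α : ℤ → V) (k : ℕ) (t : ℤ) : Prop where
  four_le : 4 ≤ t
  dist_eq : (skel X).dist (α 0) (α t) = k
  dist_lt : ∀ s, -2 ≤ s → s < t → (skel X).dist (α 0) (α s) < k

namespace IsAxis

variable {h : Equiv.Perm V} {L : ℕ} {α : ℤ → V} (A : IsAxis X h L α)
include A

theorem isFirstTime_four (hconn : (skel X).Connected) : IsFirstTime X α 4 4 := by
  refine ⟨le_rfl, ?_, fun s h1 h2 => ?_⟩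
  · simpa using A.dist_add hconn 0 A.four_le
  · have := A.dist_le_natAbs hconn 0 s
    omega

/-- The distance from `α 0` cannot stay at its maximum `k` for five more steps. The geodesics of
length four on the axis exclude all behaviour except a zigzag between the levels `k - 1` and `k`;
the vertex condition at a peak shortens it if `4 < L`, and for `L = 4` the parents of two
consecutive peaks, translated back by `h`, continue the zigzag to a time before `t`. -/
theorem exists_lt_dist (hconn : (skel X).Connected) (hF : FillsCycles X)
    (H : IsLayering X ((skel X).dist (α 0))) (hh : IsSimplicialIsometry X h) {k : ℕ} {t : ℤ}
    (ht : IsFirstTime X α k t) : ∃ s, t < s ∧ s ≤ t + 5 ∧ k < (skel X).dist (α 0) (α s) := by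
  by_contra! hcon
  have ht4 := ht.four_le
  have hn : ∀ s r, r = s + 1 → Near X (α s) (α r) := fun s r hr => hr ▸ A.near_succ s
  have hd : ∀ s r, r = s + 4 → 3 < (skel X).dist (α s) (α r) := fun s r hr => by
    have := A.dist_add hconn s A.four_le
    rw [Nat.cast_ofNat, ← hr] at this
    omega
  have hlip : ∀ s r, r = s + 1 → (skel X).dist (α 0) (α s) ≤ (skel X).dist (α 0) (α r) + 1 ∧
      (skel X).dist (α 0) (α r) ≤ (skel X).dist (α 0) (α s) + 1 := fun s r hr =>
    ⟨H.le_succ (hn s r hr), H.le_succ (hn s r hr).symm⟩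
  have f0 := ht.dist_eq
  have fm := fun s (h1 : -2 ≤ s) (h2 : s < t) => ht.dist_lt s h1 h2
  have fm1 := fm (t - 1) (by omega) (by omega)
  have fm2 := fm (t - 2) (by omega) (by omega)
  have l0 := hlip (t - 1) t (by ring)
  have l1 := hlip t (t + 1) (by ring)
  have l2 := hlip (t + 1) (t + 2) (by ring)
  have l3 := hlip (t + 2) (t + 3) (by ring)
  have f1 : (skel X).dist (α 0) (α (t + 1)) + 1 = k := by
    by_contra hne
    have h1 := H.lt_lev_of_dist hconn hF (x₃ := α (t + 2))
      ((hn (t - 1) t (by ring)).symm.par (by omega))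
      (hn t (t + 1) (by ring)) (hn _ _ (by ring)) (hn _ (t + 3) (by ring)) (by omega)
      (hd _ _ (by ring))
    have h2 := hcon (t + 3) (by omega) (by omega)
    omega
  have p1 : Par X ((skel X).dist (α 0)) (α t) (α (t - 1)) :=
    (hn _ _ (by ring)).symm.par (by omega)
  have p2 : Par X ((skel X).dist (α 0)) (α t) (α (t + 1)) := (hn _ _ (by ring)).par (by omega)
  have f2 : (skel X).dist (α 0) (α (t + 2)) = k := by
    by_contra hne
    have h2 := hcon (t + 2) (by omega) (by omega)
    have h1 := H.dist_le_three_of_peak hconn hF (hn (t - 2) _ (by ring)) p1 p2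
      (hn _ (t + 2) (by ring)) (by omega) (by omega)
    have := hd (t - 2) (t + 2) (by ring)
    omega
  have p3 : Par X ((skel X).dist (α 0)) (α (t + 2)) (α (t + 1)) :=
    (hn _ _ (by ring)).symm.par (by omega)
  have f3 : (skel X).dist (α 0) (α (t + 3)) + 1 = k := by
    by_contra hne
    have h1 := H.lt_lev_of_dist hconn hF (x₃ := α (t + 4)) p3
      (hn _ (t + 3) (by ring)) (hn _ _ (by ring)) (hn _ (t + 5) (by ring)) (by omega)
      (hd _ _ (by ring))
    have h2 := hcon (t + 5) (by omega) (by omega)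
    omega
  have p4 : Par X ((skel X).dist (α 0)) (α (t + 2)) (α (t + 3)) :=
    (hn _ _ (by ring)).par (by omega)
  obtain ⟨τ, hτ, hτ1, hτ2⟩ := H.vertex p1 p2
  obtain ⟨τ', hτ', hτ1', hτ2'⟩ := H.vertex p3 p4
  have eτ := hτ.2
  have eτ' := hτ'.2
  rcases Nat.lt_or_ge 4 L with hL | hL
  · have h1 := H.dist_le_three_of_peak hconn hF (hn (t - 2) _ (by ring)) p1 p2 hτ1'.symm
      (by omega) (by omega)
    have h2 := hconn.dist_triangle (u := α (t - 2)) (v := τ') (w := α (t + 3))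
    have h3 := A.dist_add hconn (t - 2) (j := 5) hL
    rw [Nat.cast_ofNat, show t - 2 + 5 = t + 3 by ring] at h3
    have := hτ2'.dist_le
    omega
  · obtain rfl : L = 4 := le_antisymm hL A.four_le
    have hback : ∀ {z s r}, Near X z (α s) → r = s - 4 → Near X (h.symm z) (α r) := by
      rintro z s r hz rfl
      have := hh.symm.near hz
      rwa [A.symm_apply] at this
    have fm3 := fm (t - 3) (by omega) (by omega)
    have fm5 := fm (t - 5) (by omega) (by omega)
    have fm6 := fm (t - 6) (by omega) (by omega)
    have y1 := hback (r := t - 3) hτ1' (by ring)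
    have y2 := hback (r := t - 1) hτ2' (by ring)
    have fy : (skel X).dist (α 0) (h.symm τ') = k := by
      by_contra hne
      have h1 := H.dist_le_three_of_peak hconn hF y2 p1 p2 hτ1'.symm
        (by have := H.le_succ y2; omega) (by omega)
      have := A.le_dist_symm τ'
      omega
    have z1 := hback (r := t - 5) hτ1 (by ring)
    have z2 := hback (r := t - 3) hτ2 (by ring)
    have g3 := H.le_succ y1
    have fz : (skel X).dist (α 0) (h.symm τ) = k := by
      by_contra hne
      have h1 := H.dist_le_three_of_peak hconn hF (x₂ := h.symm τ') z2 (y1.par (by omega))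
        (y2.par (by omega)) hτ1.symm (by have := H.le_succ z2; omega) (by omega)
      have := A.le_dist_symm τ
      omega
    have g5 := H.le_succ z1
    have h1 := H.dist_le_three_of_peak hconn hF (hn (t - 6) _ (by ring)) (z1.par (by omega))
      (z2.par (by omega)) (hn _ (t - 2) (by ring)) (by omega) (by omega)
    have := hd (t - 6) (t - 2) (by ring)
    omega

/-- The axis moves away from `α 0` linearly: the first times at which it reaches the successive
distances from `α 0` have gaps of at most `5`. -/
theorem exists_firstTimes (hconn : (skel X).Connected) (hF : FillsCycles X)
    (H : IsLayering X ((skel X).dist (α 0))) (hh : IsSimplicialIsometry X h) :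
    ∃ t : ℕ → ℤ, ∀ k, IsFirstTime X α (k + 4) (t k) ∧ t k < t (k + 1) ∧
      t (k + 1) ≤ t k + 5 := by
  have hstep : ∀ k r, IsFirstTime X α (k + 4) r →
      ∃ r', IsFirstTime X α (k + 1 + 4) r' ∧ r < r' ∧ r' ≤ r + 5 := by
    intro k r hr
    obtain ⟨s, hs1, hs2, hs3⟩ := A.exists_lt_dist hconn hF H hh hr
    obtain ⟨r', ⟨h1, h2⟩, h3⟩ := Int.exists_least_of_bdd
      (P := fun s => r < s ∧ k + 4 < (skel X).dist (α 0) (α s)) ⟨r, fun z hz => hz.1.le⟩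
      ⟨s, hs1, hs3⟩
    have h4 := hr.four_le
    have hlt : ∀ s, -2 ≤ s → s < r' → (skel X).dist (α 0) (α s) < k + 1 + 4 := by
      intro q hq1 hq2
      by_contra hq3
      rcases lt_trichotomy q r with h | rfl | h
      · have := hr.dist_lt q hq1 h
        omega
      · have := hr.dist_eq
        omega
      · exact absurd (h3 q ⟨h, by omega⟩) (by omega)
    have h5 := hlt (r' - 1) (by omega) (by omega)
    have h6 := A.near_succ (r' - 1)
    rw [sub_add_cancel] at h6
    have h7 := H.le_succ h6.symm
    exact ⟨r', ⟨by omega, by omega, hlt⟩, h1, (h3 s ⟨hs1, hs3⟩).trans hs2⟩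
  choose! g hg using hstep
  let t : ℕ → ℤ := fun k => Nat.rec 4 (fun k r => g k r) k
  have ht : ∀ k, IsFirstTime X α (k + 4) (t k) := by
    intro k
    induction k with
    | zero => exact A.isFirstTime_four hconn
    | succ k ih => exact (hg k _ ih).1
  exact ⟨t, fun k => ⟨ht k, (hg k _ (ht k)).2⟩⟩

end IsAxis

/-! ### Flat walks and ancestors -/

/-- `FlatWalk X lev n u w` says that `u` and `w` are joined by a walk of `n` steps within a sphere,
where a step may be constant. -/
inductive FlatWalk (X : AbstractSimplicialComplex V) (lev : V → ℕ) : ℕ → V → V → Prop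
  | refl (u : V) : FlatWalk X lev 0 u u
  | cons {n : ℕ} {u x w : V} (h : Near X u x) (hl : lev u = lev x) (hw : FlatWalk X lev n x w) :
      FlatWalk X lev (n + 1) u w

/-- `z` is an ancestor of `v`: it lies on a geodesic from the base vertex to `v`. -/
def Ancestor (X : AbstractSimplicialComplex V) (lev : V → ℕ) : V → V → Prop :=
  Relation.ReflTransGen (Par X lev)

section

variable {lev : V → ℕ}

theorem FlatWalk.trans {m n : ℕ} {u x w : V} (h : FlatWalk X lev m u x)
    (h' : FlatWalk X lev n x w) : FlatWalk X lev (m + n) u w := by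
  induction h with
  | refl u => simpa using h'
  | @cons k _ _ _ h hl _ ih =>
    rw [show k + 1 + n = k + n + 1 by ring]
    exact (ih h').cons h hl

theorem FlatWalk.mono {m n : ℕ} {u w : V} (h : FlatWalk X lev m u w) (hmn : m ≤ n) :
    FlatWalk X lev n u w := by
  induction n, hmn using Nat.le_induction with
  | base => exact h
  | succ n _ ih => exact ih.cons (Near.refl u) rfl

theorem FlatWalk.symm {n : ℕ} {u w : V} (h : FlatWalk X lev n u w) : FlatWalk X lev n w u := by
  induction h with
  | refl u => exact .refl u
  | cons h hl _ ih => exact ih.trans ((FlatWalk.refl _).cons h.symm hl.symm)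

theorem FlatWalk.lev_eq {n : ℕ} {u w : V} (h : FlatWalk X lev n u w) : lev u = lev w := by
  induction h with
  | refl u => rfl
  | cons h hl _ ih => exact hl.trans ih

theorem FlatWalk.dist_le (hconn : (skel X).Connected) {n : ℕ} {u w : V}
    (h : FlatWalk X lev n u w) : (skel X).dist u w ≤ n := by
  induction h with
  | refl u => simp
  | @cons n u x w h hl _ ih =>
    have := hconn.dist_triangle (u := u) (v := x) (w := w)
    have := h.dist_le
    omega

theorem FlatLinked.flatWalk {a b : V} (h : FlatLinked X lev a b) : FlatWalk X lev 2 a b :=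
  let ⟨_, h1, h2, h3, h4⟩ := h
  ((FlatWalk.refl b).cons h4 h2).cons h3.symm h1.symm

theorem Ancestor.lev_le {v z : V} (h : Ancestor X lev v z) : lev z ≤ lev v := by
  induction h with
  | refl => exact le_rfl
  | tail _ h ih =>
    have := h.2
    omega

theorem Ancestor.eq {v z : V} (h : Ancestor X lev v z) (hl : lev z = lev v) : v = z := by
  rcases Relation.ReflTransGen.cases_head h with rfl | ⟨p, hp, hpz⟩
  · rfl
  · have := Ancestor.lev_le hpz
    have := hp.2
    omega

theorem Ancestor.dist_add_le (hconn : (skel X).Connected) {v z : V} (h : Ancestor X lev v z) :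
    (skel X).dist z v + lev z ≤ lev v := by
  induction h with
  | refl => simp
  | @tail b c _ h ih =>
    have := hconn.dist_triangle (u := c) (v := b) (w := v)
    have := h.near.symm.dist_le
    have := h.2
    omega

theorem Ancestor.exists_par {v z : V} (h : Ancestor X lev v z) (hl : lev z < lev v) :
    ∃ p, Par X lev v p ∧ Ancestor X lev p z := by
  rcases Relation.ReflTransGen.cases_head h with rfl | h
  · omega
  · exact h

theorem Ancestor.exists_child {v z : V} (h : Ancestor X lev v z) (hl : lev z < lev v) :
    ∃ c, Ancestor X lev v c ∧ Par X lev c z := by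
  rcases Relation.ReflTransGen.cases_tail h with rfl | h
  · omega
  · exact h

namespace IsLayering

variable (H : IsLayering X lev)
include H

theorem exists_ancestor {v : V} {j : ℕ} (hj : j ≤ lev v) :
    ∃ z, Ancestor X lev v z ∧ lev z = j := by
  induction hn : lev v - j generalizing j with
  | zero => exact ⟨v, .refl, by omega⟩
  | succ n ih =>
    obtain ⟨z, hz, hl⟩ := ih (j := j + 1) (by omega) (by omega)
    obtain ⟨p, hp⟩ := H.exists_par (v := z) (by omega)
    have := hp.2
    exact ⟨p, hz.tail hp, by omega⟩

/-- Flat walks contract by the factor `2 / 3`, up to a constant, when they are pushed down by one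
level: three steps become two. -/
theorem flatWalk_par (hF : FillsCycles X) (j : ℕ) {u w a b : V}
    (h : FlatWalk X lev (3 * j + 2) u w) (ha : Par X lev u a) (hb : Par X lev w b) :
    FlatWalk X lev (2 * j + 2) a b := by
  induction j generalizing u w a b with
  | zero =>
    obtain _ | ⟨h1, e1, _ | ⟨h2, e2, _ | _⟩⟩ := h
    exact (H.flatLinked_of_two_steps hF h1 h2 e1 e2 ha hb).flatWalk
  | succ j ih =>
    obtain _ | ⟨h1, e1, _ | ⟨h2, e2, _ | ⟨h3, e3, h⟩⟩⟩ := h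
    have := ha.2
    obtain ⟨q, hq, hq'⟩ := H.triangle h3 e3 (by omega)
    have h4 := (H.flatLinked_of_two_steps hF h1 h2 e1 e2 ha hq).flatWalk
    exact (h4.trans (ih h hq' hb)).mono (by omega)

/-- Flat walks of length `2` descend to ancestors without getting longer. -/
theorem flatWalk_two_ancestor (hF : FillsCycles X) {u w z z' : V} (h : FlatWalk X lev 2 u w)
    (hz : Ancestor X lev u z) (hz' : Ancestor X lev w z') (hl : lev z = lev z') :
    FlatWalk X lev 2 z z' := by
  induction hn : lev u - lev z generalizing u w with
  | zero =>
    have h1 := hz.lev_le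
    have h2 := h.lev_eq
    rwa [← hz.eq (by omega), ← hz'.eq (by omega)]
  | succ n ih =>
    have h2 := h.lev_eq
    obtain ⟨p, hp, hpz⟩ := hz.exists_par (by omega)
    obtain ⟨q, hq, hqz⟩ := hz'.exists_par (by omega)
    have := hp.2
    exact ih (H.flatWalk_par hF 0 h hp hq) hpz hqz (by omega)

theorem flatWalk_ancestor_of_near (hF : FillsCycles X) {u w z z' : V} (h : Near X u w)
    (hz : Ancestor X lev u z) (hz' : Ancestor X lev w z') (hl : lev z = lev z') :
    FlatWalk X lev 2 z z' := by
  wlog hle : lev w ≤ lev u generalizing u w z z'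
  · exact (this h.symm hz' hz hl.symm (by omega)).symm
  have h1 := H.le_succ h
  have h2 := hz'.lev_le
  by_cases he : lev u = lev w
  · have h3 : FlatWalk X lev 1 u w := (FlatWalk.refl w).cons h he
    exact H.flatWalk_two_ancestor hF (h3.mono (by omega)) hz hz' hl
  · obtain ⟨p, hp, hpz⟩ := hz.exists_par (by omega)
    exact H.flatWalk_two_ancestor hF
      (H.flatLinked_of_par hp (h.par (by omega))).flatWalk hpz hz' hl

theorem flatWalk_ancestor_of_path (hF : FillsCycles X) {α : ℤ → V}
    (hα : ∀ s, Near X (α s) (α (s + 1))) {j : ℕ} {s : ℤ} {z : V} (hz : Ancestor X lev (α s) z)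
    (hj : lev z = j) {n : ℕ} (hn : ∀ i : ℕ, i ≤ n → j ≤ lev (α (s + i))) {z' : V}
    (hz' : Ancestor X lev (α (s + (n + 1 : ℕ))) z') (hj' : lev z' = j) :
    FlatWalk X lev (2 * (n + 1)) z z' := by
  induction n generalizing z' with
  | zero =>
    refine H.flatWalk_ancestor_of_near hF (hα s) hz ?_ (by omega)
    simpa using hz'
  | succ n ih =>
    obtain ⟨y, hy, hyj⟩ := H.exists_ancestor (hn (n + 1) le_rfl)
    have h1 := ih (fun i hi => hn i (by omega)) hy hyj
    rw [Nat.cast_succ (n + 1), ← add_assoc] at hz'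
    exact (h1.trans (H.flatWalk_ancestor_of_near hF (hα _) hy hz' (by omega))).mono (by omega)

/-- A geodesic from the base vertex to `v`, parametrized by the level. -/
theorem exists_geodesic {v : V} : ∃ σ : ℕ → V, ∀ i ≤ lev v, Ancestor X lev v (σ i) ∧
    lev (σ i) = i ∧ ∀ j ≤ i, Ancestor X lev (σ i) (σ j) := by
  induction hn : lev v generalizing v with
  | zero =>
    exact ⟨fun _ => v, fun i hi => ⟨.refl, by simp only; omega, fun _ _ => .refl⟩⟩
  | succ n ih =>
    obtain ⟨p, hp⟩ := H.exists_par (v := v) (by omega)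
    have hp2 := hp.2
    obtain ⟨σ, hσ⟩ := ih (v := p) (by omega)
    have key : ∀ i ≤ n, Ancestor X lev v (σ i) := fun i hi => (hσ i hi).1.head hp
    refine ⟨fun i => if i ≤ n then σ i else v, fun i hi => ?_⟩
    by_cases h : i ≤ n
    · simp only [h, if_true]
      refine ⟨key i h, (hσ i h).2.1, fun j hj => ?_⟩
      simpa [hj.trans h] using (hσ i h).2.2 j hj
    · simp only [h, if_false]
      refine ⟨.refl, by omega, fun j hj => ?_⟩
      split_ifs with hjn
      · exact key j hjn
      · exact .refl

end IsLayering

/-! ### Geodesics between vertices of an axis -/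

namespace IsAxis

variable {h : Equiv.Perm V} {L : ℕ} {α : ℤ → V} (A : IsAxis X h L α)
include A

/-- The ancestors on the sphere of radius `j` of the vertices `α (t m)`, for all `m ≥ j + 2`, are
within a bounded distance of each other: by contraction, a flat walk of length `32` becomes one of
length `22` on the next sphere below, and `10` further steps suffice to replace `α (t (j + 3))`
by `α (t (j + 2))`. -/
theorem flatWalk_ancestor (hF : FillsCycles X) (H : IsLayering X ((skel X).dist (α 0)))
    {t : ℕ → ℤ} (ht : ∀ k, IsFirstTime X α (k + 4) (t k) ∧ t k < t (k + 1) ∧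
      t (k + 1) ≤ t k + 5) (n : ℕ) : ∀ {j : ℕ} {z y : V},
    Ancestor X ((skel X).dist (α 0)) (α (t (j + 2 + n))) z → (skel X).dist (α 0) z = j →
    Ancestor X ((skel X).dist (α 0)) (α (t (j + 2))) y → (skel X).dist (α 0) y = j →
    FlatWalk X ((skel X).dist (α 0)) 32 z y := by
  induction n with
  | zero =>
    intro j z y hz hzj hy hyj
    exact (H.flatWalk_ancestor_of_near hF (Near.refl _) hz hy (by omega)).mono (by omega)
  | succ n ih =>
    intro j z y hz hzj hy hyj
    have hlev : ∀ k, (skel X).dist (α 0) (α (t k)) = k + 4 := fun k => (ht k).1.dist_eq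
    obtain ⟨z₁, hz₁, hz₁z⟩ := hz.exists_child (by rw [hlev, hzj]; omega)
    have e1 := hz₁z.2
    obtain ⟨y₁, hy₁, hy₁j⟩ := H.exists_ancestor (v := α (t (j + 1 + 2))) (j := j + 1)
      (by rw [hlev]; omega)
    obtain ⟨x, hx⟩ := H.exists_par (v := y₁) (by omega)
    have e2 := hx.2
    have h1 := ih (j := j + 1) (by rwa [show j + 1 + 2 + n = j + 2 + (n + 1) by ring])
      (by omega) hy₁ hy₁j
    have h2 := H.flatWalk_par hF 10 h1 hz₁z hx
    obtain ⟨-, h3, h4⟩ := ht (j + 2)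
    rw [show j + 2 + 1 = j + 3 by ring] at h3 h4
    have hgap : t (j + 1 + 2) = t (j + 2) + ((t (j + 3) - t (j + 2) - 1).toNat + 1 : ℕ) := by
      rw [show j + 1 + 2 = j + 3 by ring]
      push_cast
      omega
    have hx' : Ancestor X ((skel X).dist (α 0)) (α (t (j + 1 + 2))) x := hy₁.tail hx
    rw [hgap] at hx'
    have h5 := H.flatWalk_ancestor_of_path hF A.near_succ hy hyj (fun i hi => ?_) hx' (by omega)
    · exact (h2.trans (h5.mono (n := 10) (by omega)).symm).mono (by omega)
    · have h6 : ∀ i : ℕ, (skel X).dist (α 0) (α (t (j + 2))) ≤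
          (skel X).dist (α 0) (α (t (j + 2) + i)) + i := by
        intro i
        induction i with
        | zero => simp
        | succ i ihi =>
          have := H.le_succ (A.near_succ (t (j + 2) + i))
          rw [show t (j + 2) + ((i + 1 : ℕ) : ℤ) = t (j + 2) + i + 1 by push_cast; ring]
          omega
      have h7 := h6 i
      rw [hlev] at h7
      omega

/-- Geodesics from `α 0` to the vertices `α (t m)` stay close to the axis. -/
theorem dist_ancestor_le (hconn : (skel X).Connected) (hF : FillsCycles X)
    (H : IsLayering X ((skel X).dist (α 0))) {t : ℕ → ℤ}
    (ht : ∀ k, IsFirstTime X α (k + 4) (t k) ∧ t k < t (k + 1) ∧ t (k + 1) ≤ t k + 5)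
    {j m : ℕ} (hm : j + 2 ≤ m) {z : V} (hz : Ancestor X ((skel X).dist (α 0)) (α (t m)) z)
    (hj : (skel X).dist (α 0) z = j) : (skel X).dist z (α (t (j + 2))) ≤ 38 := by
  obtain ⟨n, rfl⟩ := Nat.exists_eq_add_of_le hm
  have h1 := (ht (j + 2)).1.dist_eq
  obtain ⟨y, hy, hyj⟩ := H.exists_ancestor (v := α (t (j + 2))) (j := j) (by omega)
  have h2 := (A.flatWalk_ancestor hF H ht n hz hj hy hyj).dist_le hconn
  have h3 := hy.dist_add_le hconn
  have h4 := hconn.dist_triangle (u := z) (v := y) (w := α (t (j + 2)))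
  omega

end IsAxis

end

/-! ### A geodesic line along the axis -/

theorem UniformlyLocallyFinite.finite_ball (hfin : UniformlyLocallyFinite X)
    (hconn : (skel X).Connected) (v : V) (n : ℕ) : {w | (skel X).dist v w ≤ n}.Finite := by
  obtain ⟨N, hN⟩ := hfin
  induction n with
  | zero =>
    refine (Set.finite_singleton v).subset fun w hw => ?_
    exact (hconn.dist_eq_zero_iff.1 (Nat.le_zero.1 hw)).symm
  | succ n ih =>
    have hfin : ∀ u, {σ : Finset V | σ ∈ X ∧ u ∈ σ}.Finite := fun u =>
      Set.finite_of_encard_le_coe (hN u)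
    refine (ih.union (ih.biUnion fun u _ => (hfin u).biUnion fun σ _ =>
      σ.finite_toSet)).subset fun w (hw : (skel X).dist v w ≤ n + 1) => ?_
    rcases Nat.le_or_eq_of_le_succ hw with h | h
    · exact Or.inl h
    · obtain ⟨p, hp⟩ := exists_dist_pred hconn v (v := w) (by omega)
      obtain ⟨-, σ, hσ, hw', hp'⟩ := hp.1
      have : (skel X).dist v p ≤ n := by
        have := hp.2
        omega
      exact Or.inr (Set.mem_biUnion this (Set.mem_biUnion (show σ ∈ _ from ⟨hσ, hp'⟩) hw'))

namespace IsAxis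

variable {h : Equiv.Perm V} {L : ℕ} {α : ℤ → V} (A : IsAxis X h L α)
include A

/-- A geodesic segment from `α 0` to a far vertex of the axis, translated by a power of `h` so that
its midpoint lies near `α 0`. -/
theorem exists_segment (hconn : (skel X).Connected) (hF : FillsCycles X)
    (H : IsLayering X ((skel X).dist (α 0))) (hh : IsSimplicialIsometry X h) (N : ℕ) :
    ∃ γ : ℤ → V,
      (∀ i j : ℤ, |i| ≤ N → |j| ≤ N → ((skel X).dist (γ i) (γ j) : ℤ) = |i - j|) ∧
      (skel X).dist (γ 0) (α 0) ≤ 38 + L ∧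
      (∀ j : ℤ, |j| ≤ N → ∃ s, (skel X).dist (γ j) (α s) ≤ 38) ∧
      ∀ s : ℤ, |s| + L ≤ N → ∃ j : ℤ, |j| ≤ N ∧ (skel X).dist (γ j) (α s) ≤ 43 := by
  obtain ⟨t, ht⟩ := A.exists_firstTimes hconn hF H hh
  have hL := A.four_le
  have hlev : ∀ k, (skel X).dist (α 0) (α (t k)) = k + 4 := fun k => (ht k).1.dist_eq
  obtain ⟨σ, hσ⟩ := H.exists_geodesic (v := α (t (2 * N + 2)))
  rw [hlev] at hσ
  have hclose : ∀ i ≤ 2 * N, (skel X).dist (σ i) (α (t (i + 2))) ≤ 38 := fun i hi =>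
    A.dist_ancestor_le hconn hF H ht (by omega) (hσ i (by omega)).1 (hσ i (by omega)).2.1
  have hgeo : ∀ j i, j ≤ i → i ≤ 2 * N → (skel X).dist (σ j) (σ i) + j = i := by
    intro j i hji hi
    obtain ⟨-, h1, h2⟩ := hσ i (by omega)
    have h3 := (hσ j (by omega)).2.1
    have h4 := (h2 j hji).dist_add_le hconn
    have h5 := hconn.dist_triangle (u := α 0) (v := σ j) (w := σ i)
    omega
  -- `q` translations by `L` carry `α 0` to within `L` of the vertex near the midpoint
  set q := t (N + 2) / L with hq
  have hq0 := Int.emod_nonneg (t (N + 2)) (show (L : ℤ) ≠ 0 by omega)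
  have hq1 := Int.emod_lt_of_pos (t (N + 2)) (show (0 : ℤ) < L by omega)
  have hq2 := Int.emod_add_mul_ediv (t (N + 2)) L
  rw [← hq, mul_comm] at hq2
  have hg := hh.zpow (-q)
  have hgα : ∀ s, (h ^ (-q)) (α s) = α (s - q * L) := fun s => by
    rw [A.zpow_apply]
    congr 1
    ring
  have hshift : ∀ v s, (skel X).dist ((h ^ (-q)) v) (α (s - q * L)) = (skel X).dist v (α s) :=
    fun v s => by rw [← hgα, hg.dist_eq hconn]
  refine ⟨fun j => (h ^ (-q)) (σ (N + j).toNat), ?_, ?_, ?_, ?_⟩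
  · intro i j hi hj
    rw [abs_le] at hi hj
    simp only
    rw [hg.dist_eq hconn]
    rcases le_total i j with hij | hij
    · have := hgeo (N + i).toNat (N + j).toNat (by omega) (by omega)
      rw [abs_sub_comm, abs_of_nonneg (by omega)]
      omega
    · have := hgeo (N + j).toNat (N + i).toNat (by omega) (by omega)
      rw [SimpleGraph.dist_comm, abs_of_nonneg (by omega)]
      omega
  · have h1 := hclose N (by omega)
    have h2 := hshift (σ N) (t (N + 2))
    have h3 := A.dist_le_natAbs hconn (t (N + 2) - q * L) 0
    have h4 := hconn.dist_triangle (u := (h ^ (-q)) (σ N)) (v := α (t (N + 2) - q * L)) (w := α 0)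
    simp only [add_zero, Int.toNat_natCast]
    omega
  · intro j hj
    rw [abs_le] at hj
    refine ⟨t ((N + j).toNat + 2) - q * L, ?_⟩
    simp only
    rw [hshift]
    exact hclose _ (by omega)
  · intro s hs
    have hs1 := neg_abs_le s
    have hs2 := le_abs_self s
    have hmono : ∀ k n : ℕ, t k + n ≤ t (k + n) := by
      intro k n
      induction n with
      | zero => simp
      | succ n ih =>
        have := (ht (k + n)).2.1
        rw [← add_assoc]
        push_cast
        omega
    have h1 := hmono 2 N
    have h2 := hmono (N + 2) N
    rw [show 2 + N = N + 2 by ring] at h1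
    rw [show N + 2 + N = 2 * N + 2 by ring] at h2
    -- the last of the first times up to `s + q * L`
    have hex : ∃ i, i ≤ 2 * N ∧ t (i + 2) ≤ s + q * L ∧ s + q * L ≤ t (i + 2) + 5 := by
      by_contra! hcon
      have h3 : ∀ i, i ≤ 2 * N → t (i + 2) ≤ s + q * L := by
        intro i hi
        induction i with
        | zero =>
          rw [zero_add]
          omega
        | succ i ih =>
          have h4 := hcon i (by omega) (ih (by omega))
          have h5 := (ht (i + 2)).2.2
          rw [show i + 2 + 1 = i + 1 + 2 by ring] at h5
          omega
      have h4 := h3 (2 * N) le_rfl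
      have h5 := hcon (2 * N) le_rfl h4
      omega
    obtain ⟨i, hi, h3, h4⟩ := hex
    refine ⟨i - N, abs_le.2 ⟨by omega, by omega⟩, ?_⟩
    have h5 := hshift (σ i) (t (i + 2))
    have h6 := hclose i hi
    have h7 := A.dist_le_natAbs hconn (t (i + 2) - q * L) s
    have h8 := hconn.dist_triangle (u := (h ^ (-q)) (σ i)) (v := α (t (i + 2) - q * L)) (w := α s)
    simp only [add_sub_cancel, Int.toNat_natCast]
    omega

/-- There is a geodesic line at finite Hausdorff distance from the axis: a limit of the segments
of `exists_segment`. -/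
theorem exists_isGeodesicLine (hconn : (skel X).Connected) (hfin : UniformlyLocallyFinite X)
    (hF : FillsCycles X) (H : IsLayering X ((skel X).dist (α 0)))
    (hh : IsSimplicialIsometry X h) :
    ∃ γ : ℤ → V, IsGeodesicLine X γ ∧ (∀ j, ∃ s, (skel X).dist (γ j) (α s) ≤ 38) ∧
      ∀ s, ∃ j, (skel X).dist (γ j) (α s) ≤ 43 := by
  choose c hc1 hc2 hc3 hc4 using A.exists_segment hconn hF H hh
  let 𝒰 : Ultrafilter ℕ := Filter.hyperfilter ℕ
  have hlarge : ∀ K : ℤ, ∀ᶠ N : ℕ in 𝒰, K ≤ N := fun K => by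
    refine Nat.hyperfilter_le_atTop ?_
    filter_upwards [Filter.eventually_ge_atTop K.toNat] with N hN
    omega
  have hlim : ∀ j, ∃ v, ∀ᶠ N in 𝒰, c N j = v := by
    intro j
    have hev : ∀ᶠ N in 𝒰, ∃ v ∈ {w | (skel X).dist (α 0) w ≤ 38 + L + j.natAbs}, c N j = v := by
      filter_upwards [hlarge |j|] with N hN
      refine ⟨_, show (skel X).dist _ _ ≤ _ from ?_, rfl⟩
      have h1 := hc1 N 0 j (by simp) hN
      have h2 := hc2 N
      have h3 := hconn.dist_triangle (u := α 0) (v := c N 0) (w := c N j)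
      rw [SimpleGraph.dist_comm] at h2
      rw [zero_sub, abs_neg, Int.abs_eq_natAbs] at h1
      omega
    obtain ⟨v, -, hv⟩ := (Ultrafilter.eventually_exists_mem_iff
      (hfin.finite_ball hconn (α 0) _)).1 hev
    exact ⟨v, hv⟩
  choose γ hγ using hlim
  refine ⟨γ, fun i j => ?_, fun j => ?_, fun s => ?_⟩
  · obtain ⟨N, h1, h2, h3, h4⟩ :=
      ((hγ i).and ((hγ j).and ((hlarge |i|).and (hlarge |j|)))).exists
    rw [← h1, ← h2]
    exact hc1 N i j h3 h4
  · obtain ⟨N, h1, h2⟩ := ((hγ j).and (hlarge |j|)).exists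
    rw [← h1]
    exact hc3 N j h2
  · -- the index of the vertex near `α s` is bounded independently of the segment
    have hev : ∀ᶠ N in 𝒰, ∃ j ∈ Set.Icc (-(81 + L + s.natAbs : ℤ)) (81 + L + s.natAbs),
        (skel X).dist (c N j) (α s) ≤ 43 := by
      filter_upwards [hlarge (|s| + L)] with N hN
      obtain ⟨j, hj, hjs⟩ := hc4 N s hN
      refine ⟨j, ?_, hjs⟩
      have h1 := hc1 N 0 j (by simp) hj
      have h2 := hc2 N
      have h3 := A.dist_le_natAbs hconn 0 s
      have h4 := hconn.dist_triangle (u := c N 0) (v := α 0) (w := c N j)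
      have h5 := hconn.dist_triangle (u := α 0) (v := α s) (w := c N j)
      rw [SimpleGraph.dist_comm] at hjs
      rw [zero_sub, abs_neg, Int.abs_eq_natAbs] at h1
      rw [sub_zero] at h3
      constructor <;> omega
    obtain ⟨j, -, hj⟩ := (Ultrafilter.eventually_exists_mem_iff (Set.finite_Icc _ _)).1 hev
    obtain ⟨N, h1, h2⟩ := (hj.and (hγ j)).exists
    exact ⟨j, h2 ▸ h1⟩

end IsAxis

/-! ### The invariant thick geodesic -/

theorem isHyperbolic_of_translationLength (h : Equiv.Perm V)
    (hlen : 3 < translationLength X h) : IsHyperbolic X h := by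
  rintro ⟨σ, hσ, hinv⟩
  obtain ⟨v, hv⟩ := (X.isRelLowerSet_faces hσ).1
  have hhv : h v ∈ σ := by
    rw [← hinv]
    simpa using hv
  have h1 : translationLength X h ≤ (skel X).dist (h v) v := ciInf_le (OrderBot.bddBelow _) v
  have h2 := (near_of_mem hσ hhv hv).dist_le
  omega

end LocatedComplex

open LocatedComplex in
theorem theorem3p8 {V : Type*} (X : AbstractSimplicialComplex V)
    (hconn : (skel X).Connected) (hfin : UniformlyLocallyFinite X)
    (hloc : IsLocated X 8) (hSD : SDPrime X)
    (h : Equiv.Perm V) (hh : IsSimplicialIsometry X h) (hlen : 3 < translationLength X h) :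
    (∃ σ : Finset V, IsInvariantSimplex X h σ) ∨
      (IsHyperbolic X h ∧
        ∃ K : PreAbstractSimplicialComplex V, IsThickGeodesic X K ∧ IsInvariantSubcomplex h K) := by
  refine Or.inr ⟨isHyperbolic_of_translationLength h hlen, ?_⟩
  obtain ⟨α, A⟩ := exists_isAxis hconn hh hlen
  obtain ⟨γ, hγ, hγα, hαγ⟩ := A.exists_isGeodesicLine hconn hfin
    (fillsCycles hconn hloc hSD) (isLayering_dist hconn hloc.1 hSD (α 0)) hh
  -- all translates of `γ` by powers of `h` are close to the axis, hence to each other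
  let F : Set (ℤ → V) := Set.range fun i : ℤ => fun n => (h ^ i) (γ n)
  refine ⟨fullSubcomplex X (⋃ c ∈ F, Set.range c), ⟨F, Set.range_nonempty _, ?_, ⟨81, ?_⟩, rfl⟩, ?_⟩
  · rintro _ ⟨i, rfl⟩ m n
    simp only
    rw [(hh.zpow i).dist_eq hconn]
    exact hγ m n
  · rintro _ ⟨i, rfl⟩ _ ⟨j, rfl⟩ n
    obtain ⟨s, hs⟩ := hγα n
    obtain ⟨m, hm⟩ := hαγ (s + (i - j) * translationLength X h)
    refine ⟨m, ?_⟩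
    rw [← (hh.zpow i).dist_eq hconn] at hs
    rw [← (hh.zpow j).dist_eq hconn, A.zpow_apply, SimpleGraph.dist_comm] at hm
    rw [A.zpow_apply] at hs
    rw [show s + (i - j) * (translationLength X h : ℤ) + j * translationLength X h
      = s + i * translationLength X h by ring] at hm
    have := hconn.dist_triangle (u := (h ^ i) (γ n))
      (v := α (s + i * translationLength X h)) (w := (h ^ j) (γ m))
    simp only
    omega
  · have hS : ∀ v, h v ∈ (⋃ c ∈ F, Set.range c) ↔ v ∈ ⋃ c ∈ F, Set.range c := by
      intro v
      simp only [F, Set.mem_iUnion, Set.mem_range, exists_prop, exists_exists_eq_and]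
      constructor
      · rintro ⟨i, n, hn⟩
        refine ⟨i - 1, n, h.injective ?_⟩
        rw [← hn, ← Equiv.Perm.mul_apply, ← zpow_one_add, add_sub_cancel]
      · rintro ⟨i, n, rfl⟩
        exact ⟨1 + i, n, by rw [zpow_one_add, Equiv.Perm.mul_apply]⟩
    intro σ
    refine and_congr (hh σ) ?_
    simp only [Finset.mem_map_equiv]
    constructor
    · intro hσ v hv
      exact (hS v).1 (hσ (h v) (by simpa using hv))
    · intro hσ v hv
      have := hσ _ hv
      rwa [← hS, Equiv.apply_symm_apply] at this
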